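/- \textbf{Theorem (Super-polynomial GPD of Sublevel-Rips and Sublevel-\v{C}ech filtrations).} \emph{Conventions.} Fix a field $\mathbb{F}$. An interval of a poset $P$ is a nonempty, convex, connected subset of $P$. For a functor $M$ from $P$ to $\mathbb{F}$-vector spaces and an interval $I$, let $\mathrm{rk}_M(I)$ be the rank of the canonical map $\varprojlim M|_I\to\varinjlim M|_I$. The generalized persistence diagram (GPD) of $M$ is the function $\mathrm{dgm}_M:\mathrm{Int}(P)\to\mathbb{Z}$ such that $\mathrm{rk}_M(I)=\sum_{J\supseteq I}\mathrm{dgm}_M(J)$ for every interval $I$, with finitely many nonzero summands; its size $\|\mathrm{dgm}_M\|$ is the cardinality of its support. For a metric space $(X,\mathsf d)$ and $\gamma:X\to\mathbb{R}$, the sublevel-Rips bifiltration $\mathrm{Rips}^{\downarrow}(X,\mathsf d,\gamma)$ over $\mathbb{R}\times\mathbb{R}_{\ge 0}$ consists at $(a,r)$ of the nonempty finite $\sigma\subseteq\gamma^{-1}((-\infty,a])$ with $\mathsf d(x,y)\le r$ for all $x,y\in\sigma$. For $X\subset\mathbb{R}^d$ with $\mathsf d$ the restriction of a metric on $\mathbb{R}^d$,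 the sublevel-\v{C}ech bifiltration $\check{\mathrm C}\mathrm{ech}^{\downarrow}(X,\mathsf d,\gamma)$ consists at $(a,r)$ of the nonempty finite $\sigma\subseteq\gamma^{-1}((-\infty,a])$ whose closed balls of radius $r$ in $\mathbb{R}^d$ have a common point. For a simplicial filtration $\mathcal F$, $\mathrm{dgm}_m(\mathcal F)$ is the GPD of $\mathrm{H}_m(\mathcal F;\mathbb F)$. \emph{(1)} For every finite metric space $X$ and every $\gamma:X\to\mathbb R$, the GPD $\mathrm{dgm}_1(\mathrm{Rips}^{\downarrow}(X,\mathsf d,\gamma))$ exists, is unique and is finitely supported; the same holds for $\mathrm{dgm}_1(\check{\mathrm C}\mathrm{ech}^{\downarrow}(X,\mathsf d,\gamma))$ for every metric on $\mathbb{R}^d$, every finite $X\subset\mathbb{R}^d$ and every $\gamma:X\to\mathbb{R}$. \emph{(2)} There does not exist $k\in\mathbb{Z}_{\ge0}$ such that $\|\mathrm{dgm}_1(\mathrm{Rips}^{\downarrow}(X,\mathsf d,\gamma))\|$ is $O(|X|^k)$ over all finite metric spaces $(X,\mathsf d)$ and all functions $\gamma:X\to\mathbb{R}$. There does not exist $k\in\mathbb{Z}_{\ge0}$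 such that $\|\mathrm{dgm}_1(\check{\mathrm C}\mathrm{ech}^{\downarrow}(X,\mathsf d,\gamma))\|$ is $O(|X|^k)$ over all $d$, all metrics on $\mathbb{R}^d$, all finite $X\subset\mathbb{R}^d$ and all $\gamma:X\to\mathbb{R}$. (Here ``$O(|X|^k)$'' means: there are constants $C,N$ such that the size is at most $C|X|^k$ whenever $|X|\ge N$.) \emph{(3)} Explicit witnesses. Let $n\ge2$, $A=\{(1,0),(0,1),(-1,0),(0,-1)\}$ and $b_j=n-j/n^2$ for $0\le j\le n$. Let $Y_i=\left(\bigcup_{0\le j\le n,\,j\ne i}b_jA\right)\times\{2in\}$ for $0\le i\le n$, $Z_i=b_0A\times\{(2i+1)n\}$ for $0\le i\le n-1$, and $X_n=\bigcup_{i=0}^{n}Y_i\cup\bigcup_{i=0}^{n-1}Z_i\subset\mathbb{R}^3$, with $\mathsf d_n$ the restriction of the supremum metric of $\mathbb{R}^3$. Let $\gamma_n:X_n\to\mathbb{R}$ be $j$ on the points of $\bigcup_i Y_i$ that project into $b_jA$, and $n$ on $\bigcup_i Z_i$. Then $|X_n|=4n(n+2)$. Put $\beta_j=b_{n-j}$,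 so that $\beta_0<\dots<\beta_n$. Let $M$ be the module $\mathrm{H}_0(\mathcal F_n;\mathbb{F})$ over $\{0,\dots,n\}^2$ (product order), where $\mathcal F_n$ has vertices $z_0,\dots,z_n$ and is, at $(i,j)$: empty if $i+j<n$; the set of all vertices except $z_i$ if $i+j=n$; the set of all vertices if $i+j>n$ and $(i,j)\ne(n,n)$; the complete graph on $z_0,\dots,z_n$ if $(i,j)=(n,n)$. Then the pullback of $\mathrm{H}_1(\mathrm{Rips}^{\downarrow}(X_n,\mathsf d_n,\gamma_n);\mathbb{F})$ along $(i,j)\mapsto(i,\beta_j)$ and the pullback of $\mathrm{H}_1(\check{\mathrm C}\mathrm{ech}^{\downarrow}(X_n,\mathsf d_n,\gamma_n);\mathbb{F})$ along $(i,j)\mapsto(i,\beta_j/2)$ are both isomorphic to $M$. The GPD of $M$ exists, is unique and is finitely supported, and each of $\|\mathrm{dgm}_M\|$, $\|\mathrm{dgm}_1(\mathrm{Rips}^{\downarrow}(X_n,\mathsf d_n,\gamma_n))\|$ and $\|\mathrm{dgm}_1(\check{\mathrm C}\mathrm{ech}^{\downarrow}(X_n,\mathsf d_n,\gamma_n))\|$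 is at least $2^{n+1}-1$. -/

import Mathlib

open CategoryTheory CategoryTheory.Limits
open scoped NNReal

universe u

noncomputable section

/-! ### Intervals, generalized rank, generalized persistence diagram -/

/-- An interval of a poset: a nonempty, convex and connected subset. -/
structure PosetInterval (P : Type) [PartialOrder P] where
  carrier : Set P
  nonempty : carrier.Nonempty
  convex : carrier.OrdConnected
  connected : ∀ p q : carrier, Relation.ReflTransGen (fun x y : carrier => x ≤ y ∨ y ≤ x) p q

/-- Persistence modules over a poset `P`: functors from `P` to vector spaces over `𝔽`. -/
abbrev PersistenceModule (𝔽 : Type u) [Field 𝔽] (P : Type) [PartialOrder P] :=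
  P ⥤ ModuleCat.{u} 𝔽

/-- The pullback of a persistence module along a monotone map. -/
def PersistenceModule.comap {𝔽 : Type u} [Field 𝔽] {P Q : Type} [PartialOrder P] [PartialOrder Q]
    (M : PersistenceModule 𝔽 Q) (g : P →o Q) : PersistenceModule 𝔽 P :=
  g.monotone.functor ⋙ M

/-- The restriction of a persistence module over `P` to a subset of `P`. -/
def PersistenceModule.restrict {𝔽 : Type u} [Field 𝔽] {P : Type} [PartialOrder P]
    (M : PersistenceModule 𝔽 P) (I : Set P) : PersistenceModule 𝔽 I :=
  M.comap ⟨fun p : I => (p : P), fun _ _ h => h⟩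

/-- The rank of the limit-to-colimit map `i_p ∘ π_p` of the restriction of `M` to the interval `I`;
since `I` is connected the map does not depend on the point `p` of `I`. -/
def generalizedRank {𝔽 : Type u} [Field 𝔽] {P : Type} [PartialOrder P]
    (M : PersistenceModule 𝔽 P) (I : PosetInterval P) : ℕ :=
  let p : I.carrier := ⟨I.nonempty.some, I.nonempty.some_mem⟩
  Module.finrank 𝔽 (LinearMap.range
    (limit.π (M.restrict I.carrier) p ≫ colimit.ι (M.restrict I.carrier) p).hom)

/-- `f` is a generalized persistence diagram of `M`: for every interval `I`, the rank of `M` over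
`I` is the sum of `f` over the intervals containing `I`, with finitely many nonzero summands. -/
def IsGPD {𝔽 : Type u} [Field 𝔽] {P : Type} [PartialOrder P]
    (M : PersistenceModule 𝔽 P) (f : PosetInterval P → ℤ) : Prop :=
  ∀ I : PosetInterval P,
    {J : PosetInterval P | I.carrier ⊆ J.carrier ∧ f J ≠ 0}.Finite ∧
    (generalizedRank M I : ℤ) = ∑ᶠ (J : PosetInterval P) (_ : I.carrier ⊆ J.carrier), f J

/-- The generalized persistence diagram of `M` (meaningful when it exists and is unique). -/
def gpd {𝔽 : Type u} [Field 𝔽] {P : Type} [PartialOrder P]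
    (M : PersistenceModule 𝔽 P) : PosetInterval P → ℤ :=
  Classical.epsilon (IsGPD M)

/-- The size of the generalized persistence diagram: the cardinality of its support. -/
def gpdSize {𝔽 : Type u} [Field 𝔽] {P : Type} [PartialOrder P]
    (M : PersistenceModule 𝔽 P) : ℕ∞ :=
  (Function.support (gpd M)).encard

/-- The generalized persistence diagram of `M` exists, is unique, and is finitely supported. -/
def HasFiniteGPD {𝔽 : Type u} [Field 𝔽] {P : Type} [PartialOrder P]
    (M : PersistenceModule 𝔽 P) : Prop :=
  (∃! f : PosetInterval P → ℤ, IsGPD M f) ∧ (Function.support (gpd M)).Finite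

/-! ### Simplicial homology -/

section Subquotient

variable {𝔽 : Type u} [Field 𝔽] {W : Type u} [AddCommGroup W] [Module 𝔽 W]

/-- For subspaces `B ≤ Z`, the quotient `Z / B`. -/
def Subquotient (Z B : Submodule 𝔽 W) : Type u := Z ⧸ B.submoduleOf Z

instance (Z B : Submodule 𝔽 W) : AddCommGroup (Subquotient Z B) :=
  inferInstanceAs (AddCommGroup (Z ⧸ B.submoduleOf Z))

instance (Z B : Submodule 𝔽 W) : Module 𝔽 (Subquotient Z B) :=
  inferInstanceAs (Module 𝔽 (Z ⧸ B.submoduleOf Z))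

/-- The class map `Z → Z / B`. -/
def Subquotient.mk (Z B : Submodule 𝔽 W) : Z →ₗ[𝔽] Subquotient Z B :=
  (B.submoduleOf Z).mkQ

theorem Subquotient.mk_surjective (Z B : Submodule 𝔽 W) :
    Function.Surjective (Subquotient.mk Z B) :=
  (B.submoduleOf Z).mkQ_surjective

theorem Subquotient.mk_eq_zero {Z B : Submodule 𝔽 W} (x : Z) :
    Subquotient.mk Z B x = 0 ↔ (x : W) ∈ B :=
  Submodule.Quotient.mk_eq_zero (B.submoduleOf Z)

/-- The map `Z / B → Z' / B'` induced by inclusions `Z ≤ Z'` and `B ≤ B'`. -/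
def Subquotient.map {Z Z' B B' : Submodule 𝔽 W} (hZ : Z ≤ Z') (hB : B ≤ B') :
    Subquotient Z B →ₗ[𝔽] Subquotient Z' B' :=
  Submodule.mapQ (B.submoduleOf Z) (B'.submoduleOf Z') (Submodule.inclusion hZ)
    (fun _ hc => hB hc)

theorem Subquotient.map_mk {Z Z' B B' : Submodule 𝔽 W} (hZ : Z ≤ Z') (hB : B ≤ B') (x : Z) :
    Subquotient.map hZ hB (Subquotient.mk Z B x) =
      Subquotient.mk Z' B' (Submodule.inclusion hZ x) :=
  rfl

end Subquotient

section Homology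

variable (𝔽 : Type u) [Field 𝔽] {V : Type}

/-- Oriented simplicial `m`-chains of `K`: finitely supported functions on orderings
`(v₀, …, v_m)` of the `m`-simplices of `K` that change by the sign of the permutation when the
vertices are permuted. The oriented simplex `[v₀, …, v_m]` is the function with value `sign σ` on
the ordering `v ∘ σ` and value `0` elsewhere. -/
def simplicialChains (K : PreAbstractSimplicialComplex V) (m : ℕ) :
    Submodule 𝔽 ((Fin (m + 1) → V) →₀ 𝔽) where
  carrier := {c |
    (∀ v, c v ≠ 0 → Function.Injective v ∧ ∃ s ∈ K.faces, (s : Set V) = Set.range v) ∧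
    ∀ (σ : Equiv.Perm (Fin (m + 1))) (v : Fin (m + 1) → V),
      c (v ∘ σ) = ((Equiv.Perm.sign σ : ℤ) : 𝔽) * c v}
  add_mem' := by
    rintro c d ⟨hc, hc'⟩ ⟨hd, hd'⟩
    refine ⟨fun v hv => ?_, fun σ v => ?_⟩
    · by_cases h : c v = 0
      · refine hd v fun h' => hv ?_
        simp [h, h']
      · exact hc v h
    · simp [hc', hd', mul_add]
  zero_mem' := by simp
  smul_mem' := by
    rintro a c ⟨hc, hc'⟩
    refine ⟨fun v hv => hc v fun h => hv (by simp [h]), fun σ v => ?_⟩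
    simp only [Finsupp.smul_apply, hc', smul_eq_mul]
    ring

/-- The boundary map. On `c` it is `(∂c)(w₁, …, w_m) = ∑ x, c (x, w₁, …, w_m)`, so the oriented
simplex `[v₀, …, v_m]` goes to the sum of the terms `(-1)^i [v₀, …, v_{i-1}, v_{i+1}, …, v_m]`. -/
def simplicialBoundary (V : Type) (m : ℕ) :
    ((Fin (m + 1) → V) →₀ 𝔽) →ₗ[𝔽] ((Fin m → V) →₀ 𝔽) :=
  Finsupp.lmapDomain 𝔽 𝔽 Fin.tail

/-- The `m`-cycles of `K` (every `0`-chain is a cycle). -/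
def simplicialCycles (K : PreAbstractSimplicialComplex V) (m : ℕ) :
    Submodule 𝔽 ((Fin (m + 1) → V) →₀ 𝔽) :=
  if m = 0 then simplicialChains 𝔽 K m
  else simplicialChains 𝔽 K m ⊓ LinearMap.ker (simplicialBoundary 𝔽 V m)

/-- The `m`-boundaries of `K`. -/
def simplicialBoundaries (K : PreAbstractSimplicialComplex V) (m : ℕ) :
    Submodule 𝔽 ((Fin (m + 1) → V) →₀ 𝔽) :=
  (simplicialChains 𝔽 K (m + 1)).map (simplicialBoundary 𝔽 V (m + 1))

theorem simplicialBoundary_mem_chains {K : PreAbstractSimplicialComplex V} {m : ℕ}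
    {c : (Fin (m + 1 + 1) → V) →₀ 𝔽} (hc : c ∈ simplicialChains 𝔽 K (m + 1)) :
    simplicialBoundary 𝔽 V (m + 1) c ∈ simplicialChains 𝔽 K m := by
  classical
  obtain ⟨hs, ha⟩ := hc
  refine ⟨fun w hw => ?_, fun σ w => ?_⟩
  · obtain ⟨v, hv, rfl⟩ : ∃ v, c v ≠ 0 ∧ Fin.tail v = w := by
      have h1 : w ∈ (Finsupp.mapDomain Fin.tail c).support := Finsupp.mem_support_iff.2 hw
      obtain ⟨v, hv, hvw⟩ := Finset.mem_image.1 (Finsupp.mapDomain_support h1)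
      exact ⟨v, Finsupp.mem_support_iff.1 hv, hvw⟩
    obtain ⟨hi, s, hsK, hsv⟩ := hs v hv
    refine ⟨hi.comp (Fin.succ_injective _), Finset.univ.image (Fin.tail v), ?_, by simp⟩
    refine (K.isRelLowerSet_faces hsK).2 ?_ (Finset.univ_nonempty.image _)
    intro x hx
    obtain ⟨i, -, rfl⟩ := Finset.mem_image.1 hx
    exact Finset.mem_coe.1 (hsv ▸ ⟨i.succ, rfl⟩)
  · let τ : Equiv.Perm (Fin (m + 1 + 1)) := Equiv.Perm.decomposeFin.symm (0, σ)
    have hτ : Equiv.Perm.sign τ = Equiv.Perm.sign σ := by simp [τ]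
    let e : (Fin (m + 1 + 1) → V) ≃ (Fin (m + 1 + 1) → V) := τ.arrowCongr (Equiv.refl V)
    let e' : (Fin (m + 1) → V) ≃ (Fin (m + 1) → V) := σ.arrowCongr (Equiv.refl V)
    have h1 : Finsupp.mapDomain e c = ((Equiv.Perm.sign σ : ℤ) : 𝔽) • c := by
      ext v
      rw [← hτ, Finsupp.smul_apply, smul_eq_mul, ← ha τ v, Finsupp.mapDomain_equiv_apply]
      rfl
    have h2 : Fin.tail ∘ e = e' ∘ (Fin.tail : (Fin (m + 1 + 1) → V) → _) := by
      funext v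
      funext i
      have h3 : τ.symm i.succ = (σ.symm i).succ := by
        rw [Equiv.symm_apply_eq]
        simp [τ]
      simp [e, e', Fin.tail, Equiv.arrowCongr, h3]
    have h4 : Finsupp.mapDomain e' (Finsupp.mapDomain Fin.tail c) =
        ((Equiv.Perm.sign σ : ℤ) : 𝔽) • Finsupp.mapDomain Fin.tail c := by
      rw [← Finsupp.mapDomain_comp, ← h2, Finsupp.mapDomain_comp, h1, Finsupp.mapDomain_smul]
    have h5 := DFunLike.congr_fun h4 w
    rw [Finsupp.mapDomain_equiv_apply] at h5
    exact h5

theorem simplicialBoundary_comp {K : PreAbstractSimplicialComplex V} {m : ℕ}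
    {c : (Fin (m + 1 + 1) → V) →₀ 𝔽} (hc : c ∈ simplicialChains 𝔽 K (m + 1)) :
    simplicialBoundary 𝔽 V m (simplicialBoundary 𝔽 V (m + 1) c) = 0 := by
  obtain ⟨hs, ha⟩ := hc
  have hsw : ∀ v, c (v ∘ Equiv.swap 0 1) = - c v := fun v => by
    rw [ha, Equiv.Perm.sign_swap (by simp)]
    simp
  change Finsupp.mapDomain Fin.tail (Finsupp.mapDomain Fin.tail c) = 0
  rw [← Finsupp.mapDomain_comp]
  refine Finset.sum_involution (fun v _ => v ∘ Equiv.swap 0 1) ?_ ?_ ?_ ?_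
  · intro v hv
    have h1 : (Fin.tail ∘ Fin.tail) (v ∘ Equiv.swap 0 1) =
        ((Fin.tail ∘ Fin.tail) v : Fin m → V) := by
      funext i
      have : Equiv.swap (0 : Fin (m + 1 + 1)) 1 i.succ.succ = i.succ.succ :=
        Equiv.swap_apply_of_ne_of_ne (by simp) (by simp [Fin.ext_iff])
      simp [Fin.tail, this]
    beta_reduce
    rw [h1, hsw, ← Finsupp.single_add]
    simp
  · intro v hv _ h
    have hi := (hs v (Finsupp.mem_support_iff.1 hv)).1
    have h0 := congrFun h 0
    simp only [Function.comp_apply, Equiv.swap_apply_left] at h0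
    exact absurd (hi h0) (by simp)
  · intro v hv
    rw [Finsupp.mem_support_iff] at hv ⊢
    rwa [hsw, neg_ne_zero]
  · intro v hv
    funext i
    simp

theorem simplicialBoundaries_le_cycles (K : PreAbstractSimplicialComplex V) (m : ℕ) :
    simplicialBoundaries 𝔽 K m ≤ simplicialCycles 𝔽 K m := by
  rintro _ ⟨c, hc, rfl⟩
  unfold simplicialCycles
  split_ifs
  · exact simplicialBoundary_mem_chains 𝔽 hc
  · exact ⟨simplicialBoundary_mem_chains 𝔽 hc, simplicialBoundary_comp 𝔽 hc⟩

/-- Simplicial homology `H_m(K; 𝔽)`: cycles modulo boundaries. -/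
abbrev SimplicialHomology (K : PreAbstractSimplicialComplex V) (m : ℕ) : Type u :=
  Subquotient (simplicialCycles 𝔽 K m) (simplicialBoundaries 𝔽 K m)

theorem simplicialChains_mono {K L : PreAbstractSimplicialComplex V} (h : K ≤ L) (m : ℕ) :
    simplicialChains 𝔽 K m ≤ simplicialChains 𝔽 L m := by
  rintro c ⟨hc, hc'⟩
  refine ⟨fun v hv => ?_, hc'⟩
  obtain ⟨hi, s, hs, hsv⟩ := hc v hv
  exact ⟨hi, s, h hs, hsv⟩

theorem simplicialCycles_mono {K L : PreAbstractSimplicialComplex V} (h : K ≤ L) (m : ℕ) :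
    simplicialCycles 𝔽 K m ≤ simplicialCycles 𝔽 L m := by
  unfold simplicialCycles
  split_ifs
  · exact simplicialChains_mono 𝔽 h m
  · exact inf_le_inf_right _ (simplicialChains_mono 𝔽 h m)

/-- The map on homology induced by an inclusion of complexes. -/
def simplicialHomologyMap {K L : PreAbstractSimplicialComplex V} (h : K ≤ L) (m : ℕ) :
    SimplicialHomology 𝔽 K m →ₗ[𝔽] SimplicialHomology 𝔽 L m :=
  Subquotient.map (simplicialCycles_mono 𝔽 h m)
    (Submodule.map_mono (simplicialChains_mono 𝔽 h (m + 1)))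

/-- `H_m(-; 𝔽)` as a functor on the poset of simplicial complexes with vertices in `V`. -/
def simplicialHomologyFunctor (V : Type) (m : ℕ) :
    PreAbstractSimplicialComplex V ⥤ ModuleCat.{u} 𝔽 where
  obj K := ModuleCat.of 𝔽 (SimplicialHomology 𝔽 K m)
  map f := ModuleCat.ofHom (simplicialHomologyMap 𝔽 f.le m)
  map_id K := by
    ext x
    obtain ⟨x, rfl⟩ := Subquotient.mk_surjective _ _ x
    rfl
  map_comp f g := by
    ext x
    obtain ⟨x, rfl⟩ := Subquotient.mk_surjective _ _ x
    rfl

/-- The persistence module `H_m(F; 𝔽)` of a simplicial filtration `F` over a poset `P`. -/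
def persistentHomology {P : Type} [PartialOrder P]
    (F : P →o PreAbstractSimplicialComplex V) (m : ℕ) : PersistenceModule 𝔽 P :=
  F.monotone.functor ⋙ simplicialHomologyFunctor 𝔽 V m

end Homology

/-! ### Sublevel-Rips and sublevel-Čech bifiltrations -/

/-- The Vietoris–Rips complex at scale `r` of the subspace `S` of a metric space `X`. -/
def ripsComplex {X : Type} [MetricSpace X] (S : Set X) (r : ℝ≥0) :
    PreAbstractSimplicialComplex X where
  faces := {s | s.Nonempty ∧ (s : Set X) ⊆ S ∧ ∀ x ∈ s, ∀ y ∈ s, dist x y ≤ r}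
  isRelLowerSet_faces := by
    rintro s ⟨hs, hS, hr⟩
    exact ⟨hs, fun t hts ht =>
      ⟨ht, fun x hx => hS (hts hx), fun x hx y hy => hr x (hts hx) y (hts hy)⟩⟩

/-- For a subset `X` of a metric space `E` and `S ⊆ X`, the Čech complex of `S` in `E` at
scale `r`: the finite sets of points of `S` whose closed `r`-balls in `E` have a common point. -/
def cechComplex {E : Type} [MetricSpace E] {X : Set E} (S : Set X) (r : ℝ≥0) :
    PreAbstractSimplicialComplex X where
  faces := {s | s.Nonempty ∧ (s : Set X) ⊆ S ∧
    (⋂ x ∈ s, Metric.closedBall (x : E) (r : ℝ)).Nonempty}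
  isRelLowerSet_faces := by
    rintro s ⟨hs, hS, y, hy⟩
    refine ⟨hs, fun t hts ht => ⟨ht, fun x hx => hS (hts hx), y, ?_⟩⟩
    simp only [Set.mem_iInter] at hy ⊢
    exact fun x hx => hy x (hts hx)

/-- The sublevel-Rips bifiltration of `(X, d, γ)` over `ℝ × ℝ≥0`. -/
def sublevelRips {X : Type} [MetricSpace X] (γ : X → ℝ) :
    ℝ × ℝ≥0 →o PreAbstractSimplicialComplex X where
  toFun p := ripsComplex (γ ⁻¹' Set.Iic p.1) p.2
  monotone' := by
    rintro p q hpq s ⟨hs, hS, hr⟩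
    exact ⟨hs, fun x hx => le_trans (hS hx) hpq.1,
      fun x hx y hy => (hr x hx y hy).trans (NNReal.coe_le_coe.2 hpq.2)⟩

/-- The sublevel-Čech bifiltration of `(X, d, γ)` over `ℝ × ℝ≥0`, for `X` a subset of the ambient
metric space `E`. -/
def sublevelCech {E : Type} [MetricSpace E] {X : Set E} (γ : X → ℝ) :
    ℝ × ℝ≥0 →o PreAbstractSimplicialComplex X where
  toFun p := cechComplex (γ ⁻¹' Set.Iic p.1) p.2
  monotone' := by
    rintro p q hpq s ⟨hs, hS, y, hy⟩
    refine ⟨hs, fun x hx => le_trans (hS hx) hpq.1, y, ?_⟩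
    simp only [Set.mem_iInter] at hy ⊢
    exact fun x hx => Metric.closedBall_subset_closedBall (NNReal.coe_le_coe.2 hpq.2) (hy x hx)

/-! ### The super-polynomial module over `[n]²` -/

/-- The filtration over `[n]² = {0, …, n}²` with vertices `z₀, …, z_n` that is empty for
`i + j < n`, consists of the vertices other than `z_i` for `i + j = n`, of all vertices for
`i + j > n`, and is the complete graph at `(n, n)`. -/
def modelFiltration (n : ℕ) :
    Fin (n + 1) × Fin (n + 1) →o PreAbstractSimplicialComplex (Fin (n + 1)) where
  toFun p :=
    { faces := {s | s.Nonempty ∧ n ≤ (p.1 : ℕ) + p.2 ∧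
        ((s.card = 1 ∧ ((p.1 : ℕ) + p.2 = n → p.1 ∉ s)) ∨
          ((p.1 : ℕ) = n ∧ (p.2 : ℕ) = n ∧ s.card ≤ 2))}
      isRelLowerSet_faces := by
        rintro s ⟨hs, hn, h⟩
        refine ⟨hs, fun t hts ht => ⟨ht, hn, ?_⟩⟩
        have h1 : t.card ≤ s.card := Finset.card_le_card hts
        have h2 : 0 < t.card := ht.card_pos
        rcases h with ⟨hc, hp⟩ | ⟨ha, hb, hc⟩
        · exact Or.inl ⟨by omega, fun e hpt => hp e (hts hpt)⟩
        · exact Or.inr ⟨ha, hb, by omega⟩ }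
  monotone' := by
    rintro ⟨a, b⟩ ⟨c, d⟩ ⟨hac, hbd⟩ s ⟨hs, hn, h⟩
    have hac' : (a : ℕ) ≤ c := hac
    have hbd' : (b : ℕ) ≤ d := hbd
    have hc := c.isLt
    have hd := d.isLt
    simp only at hn h
    refine Set.mem_ofPred.2 ⟨hs, by simp only; omega, ?_⟩
    simp only
    rcases h with ⟨h1, hp⟩ | ⟨ha, hb, h2⟩
    · refine Or.inl ⟨h1, fun e => ?_⟩
      have : a = c := Fin.ext (by omega)
      subst this
      exact hp (by omega)
    · exact Or.inr ⟨by omega, by omega, h2⟩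

/-- The module `H_0` of the filtration above. -/
def modelModule (𝔽 : Type u) [Field 𝔽] (n : ℕ) :
    PersistenceModule 𝔽 (Fin (n + 1) × Fin (n + 1)) :=
  persistentHomology 𝔽 (modelFiltration n) 0

/-! ### The witnesses in `ℝ³` with the supremum metric -/

/-- `A = {(1,0), (0,1), (-1,0), (0,-1)}`. -/
def directions : Set (ℝ × ℝ) := {(1, 0), (0, 1), (-1, 0), (0, -1)}

/-- `b_j = n - j / n²`. -/
def witnessRadius (n j : ℕ) : ℝ := (n : ℝ) - (j : ℝ) / (n : ℝ) ^ 2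

/-- The four points `b_j A`, placed in the plane at height `h`. -/
def witnessSquare (n j : ℕ) (h : ℝ) : Set (Fin 3 → ℝ) :=
  {w | ∃ a ∈ directions, w = ![witnessRadius n j * a.1, witnessRadius n j * a.2, h]}

/-- `Y_i`, in the plane `z = 2in`: the union of the squares `b_j A` with `0 ≤ j ≤ n`, `j ≠ i`. -/
def witnessY (n i : ℕ) : Set (Fin 3 → ℝ) :=
  ⋃ j ∈ {j : ℕ | j ≤ n ∧ j ≠ i}, witnessSquare n j (2 * i * n)

/-- `Z_i`, in the plane `z = (2i+1)n`: the square `b_0 A`. -/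
def witnessZ (n i : ℕ) : Set (Fin 3 → ℝ) :=
  witnessSquare n 0 ((2 * i + 1) * n)

/-- `X_n = Y_0 ∪ ⋯ ∪ Y_n ∪ Z_0 ∪ ⋯ ∪ Z_{n-1}`. Here `Fin 3 → ℝ` carries the supremum metric. -/
def witnessSet (n : ℕ) : Set (Fin 3 → ℝ) :=
  (⋃ i ∈ {i : ℕ | i ≤ n}, witnessY n i) ∪ ⋃ i ∈ {i : ℕ | i < n}, witnessZ n i

open Classical in
/-- `γ_n` equals `n` on the sets `Z_i`, and `j` on the points of the sets `Y_i` that project into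
`b_j A`: these have `|x| + |y| = b_j`, so `j = (n - (|x| + |y|)) n²`. -/
def witnessGamma (n : ℕ) (w : witnessSet n) : ℝ :=
  if ∃ i < n, (w : Fin 3 → ℝ) ∈ witnessZ n i then n
  else ((n : ℝ) - (|(w : Fin 3 → ℝ) 0| + |(w : Fin 3 → ℝ) 1|)) * (n : ℝ) ^ 2

theorem witnessGamma_of_mem_Z {n i : ℕ} (hi : i < n) (w : witnessSet n)
    (hw : (w : Fin 3 → ℝ) ∈ witnessZ n i) : witnessGamma n w = n :=
  if_pos ⟨i, hi, hw⟩

theorem witnessGamma_of_mem_Y {n i j : ℕ} (hn : 2 ≤ n) (hj : j ≤ n) (w : witnessSet n)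
    (hw : (w : Fin 3 → ℝ) ∈ witnessSquare n j (2 * i * n)) : witnessGamma n w = j := by
  have hn' : (2 : ℝ) ≤ n := by exact_mod_cast hn
  have hj' : (j : ℝ) ≤ n := by exact_mod_cast hj
  have hb : 0 ≤ witnessRadius n j := by
    unfold witnessRadius
    rw [sub_nonneg, div_le_iff₀ (by positivity)]
    nlinarith [pow_le_pow_left₀ (by norm_num) hn' 2]
  obtain ⟨a, ha, hwa⟩ := hw
  rw [witnessGamma, if_neg]
  · have hs : |(w : Fin 3 → ℝ) 0| + |(w : Fin 3 → ℝ) 1| = witnessRadius n j := by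
      rw [hwa]
      rcases ha with rfl | rfl | rfl | rfl <;> simp [abs_of_nonneg hb]
    rw [hs, witnessRadius]
    field_simp
    ring
  · rintro ⟨k, -, a', -, hwa'⟩
    have h2 : (2 * i * n : ℝ) = (2 * k + 1) * n := by
      have := congrFun (hwa.symm.trans hwa') 2
      simpa using this
    have h3 : (2 * i : ℝ) = 2 * k + 1 := mul_right_cancel₀ (by positivity) h2
    have h4 : 2 * i = 2 * k + 1 := by exact_mod_cast h3
    omega

/-- The embedding `(i, j) ↦ (i, s β_j)` of the grid `[n]²` in `ℝ × ℝ≥0`, where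
`β_j = b_{n-j} = n - (n - j) / n²`, so that `{β_0 < ⋯ < β_n} = {b_n < ⋯ < b_0}`. -/
def gridEmbedding (n : ℕ) (s : ℝ≥0) : Fin (n + 1) × Fin (n + 1) →o ℝ × ℝ≥0 where
  toFun p := ((p.1 : ℕ), s * (witnessRadius n (n - p.2)).toNNReal)
  monotone' := by
    rintro ⟨a, b⟩ ⟨c, d⟩ ⟨hac, hbd⟩
    have hac' : (a : ℕ) ≤ c := hac
    have hbd' : n - (d : ℕ) ≤ n - b := Nat.sub_le_sub_left hbd n
    refine ⟨by simpa using hac', mul_le_mul_right (Real.toNNReal_le_toNNReal ?_) _⟩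
    unfold witnessRadius
    gcongr

end
/-!
The rank of the model over the interval of all points above the antidiagonal `i + j = n`, together
with the antidiagonal points `(i, n - i)` for `i ∈ S`, is `1` if `S` is proper and `0` otherwise:
a section is given by one common `0`-chain, from which `(i, n - i)` removes the vertex `z_i`. Push
the diagram forward along the map sending an interval to its trace on the antidiagonal. The result
is a function of subsets whose sums over supersets are `1, …, 1, 0`, so by Möbius inversion it
vanishes at none of the `2 ^ (n + 1) - 1` proper subsets. A join-preserving map of posets carries
these intervals to intervals of the same rank, by convex hulls of images, so the bound passes to
every module that restricts to the model along such a map.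

Winding numbers around the vertical axis, one for each plane of the witness, identify its first
homology with the model. Their injectivity is shown dually: a `1`-cocycle is a coboundary plus a
combination of windings. By the Helly property of boxes, the Čech complex of radius `r` in the
supremum metric is the Rips complex of scale `2 * r`.

Diagrams exist because the filtrations factor through a lattice homomorphism onto a finite product
of chains. Such a homomorphism induces isomorphisms on limits and colimits over preimages of
intervals, so diagrams pull back along it.
-/

/-! ### Zigzags and the limit-to-colimit rank -/

/-- Any two elements of `S` are joined by a zigzag of comparable elements of `S`. This is the
connectedness clause of `PosetInterval`. -/
def IsZigzagConnected {P : Type*} [Preorder P] (S : Set P) : Prop :=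
  ∀ p q : S, Relation.ReflTransGen (fun x y : S => x ≤ y ∨ y ≤ x) p q

theorem isZigzagConnected_of_directedOn {P : Type*} [Preorder P] {S : Set P}
    (hS : DirectedOn (· ≤ ·) S) : IsZigzagConnected S := by
  rintro ⟨p, hp⟩ ⟨q, hq⟩
  obtain ⟨r, hr, hpr, hqr⟩ := hS p hp q hq
  exact .tail (b := ⟨r, hr⟩) (.single (.inl hpr)) (.inr hqr)

theorem IsZigzagConnected.of_surjective {P Q : Type*} [Preorder P] [Preorder Q] {S : Set P}
    {T : Set Q} (hS : IsZigzagConnected S) {f : S → T} (hf : Monotone f)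
    (hsurj : Function.Surjective f) : IsZigzagConnected T :=
  hsurj.forall₂.2 fun p q => (hS p q).lift f fun _ _ => Or.imp (@hf _ _) (@hf _ _)

theorem IsZigzagConnected.setOf_coe {P : Type*} [Preorder P] {I : Set P} {φ : P → Prop}
    (h : IsZigzagConnected {p ∈ I | φ p}) : IsZigzagConnected {x : I | φ x} :=
  h.of_surjective (f := fun x => ⟨⟨x.1, x.2.1⟩, x.2.2⟩) (fun _ _ => id)
    fun x => ⟨⟨x.1, x.1.2, x.2⟩, rfl⟩

section Rank

variable {𝔽 : Type u} [Field 𝔽]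

section

variable {J K : Type} [Preorder J] [Preorder K]

/-- The rank of the map from the limit to the colimit of `F` through the object at `j`. -/
noncomputable def limitColimitRank (F : J ⥤ ModuleCat.{u} 𝔽) (j : J) : ℕ :=
  Module.finrank 𝔽 (LinearMap.range (limit.π F j ≫ colimit.ι F j).hom)

theorem finrank_range_iso_comp_iso {A B C D : ModuleCat.{u} 𝔽} (e : A ≅ B) (f : B ⟶ C)
    (e' : C ≅ D) :
    Module.finrank 𝔽 (LinearMap.range (e.hom ≫ f ≫ e'.hom).hom) =
      Module.finrank 𝔽 (LinearMap.range f.hom) := by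
  have hcomp : (e.hom ≫ f ≫ e'.hom).hom = (e'.toLinearEquiv.toLinearMap ∘ₗ f.hom) ∘ₗ
      e.toLinearEquiv.toLinearMap := rfl
  rw [hcomp, LinearMap.range_comp_of_range_eq_top _ (LinearEquiv.range _), LinearMap.range_comp]
  exact LinearEquiv.finrank_map_eq _ _

theorem limitColimitRank_eq_of_le (F : J ⥤ ModuleCat.{u} 𝔽) {i j : J} (h : i ≤ j) :
    limitColimitRank F i = limitColimitRank F j := by
  have hmap : limit.π F i ≫ colimit.ι F i = limit.π F j ≫ colimit.ι F j := by
    rw [← limit.w F (homOfLE h), Category.assoc, colimit.w]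
  rw [limitColimitRank, limitColimitRank, hmap]

theorem limitColimitRank_eq_of_zigzag (F : J ⥤ ModuleCat.{u} 𝔽) {i j : J}
    (h : Relation.ReflTransGen (fun x y : J => x ≤ y ∨ y ≤ x) i j) :
    limitColimitRank F i = limitColimitRank F j := by
  induction h with
  | refl => rfl
  | tail _ hstep ih =>
    exact ih.trans <| hstep.elim (limitColimitRank_eq_of_le F)
      fun h => (limitColimitRank_eq_of_le F h).symm

theorem limitColimitRank_congr {F G : J ⥤ ModuleCat.{u} 𝔽} (e : F ≅ G) (j : J) :
    limitColimitRank F j = limitColimitRank G j := by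
  have hmap : limit.π F j ≫ colimit.ι F j = (HasLimit.isoOfNatIso e).hom ≫
      (limit.π G j ≫ colimit.ι G j) ≫ (HasColimit.isoOfNatIso e).symm.hom := by
    simp
  rw [limitColimitRank, hmap, finrank_range_iso_comp_iso, limitColimitRank]

theorem limitColimitRank_comp (G : J ⥤ K) [G.Initial] [G.Final] (F : K ⥤ ModuleCat.{u} 𝔽)
    (j : J) : limitColimitRank (G ⋙ F) j = limitColimitRank F (G.obj j) := by
  have hmap : limit.π F (G.obj j) ≫ colimit.ι F (G.obj j) =
      (asIso (limit.pre F G)).hom ≫ (limit.π (G ⋙ F) j ≫ colimit.ι (G ⋙ F) j) ≫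
        (asIso (colimit.pre F G)).hom := by
    simp [colimit.ι_pre]
  rw [limitColimitRank, limitColimitRank, hmap, finrank_range_iso_comp_iso]

end

section

variable {J K : Type*} [Preorder J] [Preorder K] {g : J → K}

theorem final_functor_of_isZigzagConnected (hg : Monotone g) (hne : ∀ k, {j | k ≤ g j}.Nonempty)
    (hc : ∀ k, IsZigzagConnected {j | k ≤ g j}) : hg.functor.Final where
  out k := by
    have : Nonempty (StructuredArrow k hg.functor) :=
      (hne k).elim fun j hj => ⟨.mk (Y := j) (homOfLE hj)⟩
    refine zigzag_isConnected fun a b => ?_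
    refine (hc k ⟨a.right, leOfHom a.hom⟩ ⟨b.right, leOfHom b.hom⟩).lift
      (fun j => StructuredArrow.mk (S := k) (T := hg.functor) (Y := j.1) (homOfLE j.2)) ?_
    exact fun _ _ h => h.imp (fun h => ⟨StructuredArrow.homMk (homOfLE h)⟩)
      fun h => ⟨StructuredArrow.homMk (homOfLE h)⟩

theorem initial_functor_of_isZigzagConnected (hg : Monotone g) (hne : ∀ k, {j | g j ≤ k}.Nonempty)
    (hc : ∀ k, IsZigzagConnected {j | g j ≤ k}) : hg.functor.Initial where
  out k := by
    have : Nonempty (CostructuredArrow hg.functor k) :=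
      (hne k).elim fun j hj => ⟨.mk (Y := j) (homOfLE hj)⟩
    refine zigzag_isConnected fun a b => ?_
    refine (hc k ⟨a.left, leOfHom a.hom⟩ ⟨b.left, leOfHom b.hom⟩).lift
      (fun j => CostructuredArrow.mk (S := hg.functor) (T := k) (Y := j.1) (homOfLE j.2)) ?_
    exact fun _ _ h => h.imp (fun h => ⟨CostructuredArrow.homMk (homOfLE h)⟩)
      fun h => ⟨CostructuredArrow.homMk (homOfLE h)⟩

end

variable {P Q : Type} [PartialOrder P] [PartialOrder Q]

theorem generalizedRank_eq (M : PersistenceModule 𝔽 P) (I : PosetInterval P) (p : I.carrier) :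
    generalizedRank M I = limitColimitRank (M.restrict I.carrier) p :=
  limitColimitRank_eq_of_zigzag _ (I.connected _ _)

theorem generalizedRank_congr {M N : PersistenceModule 𝔽 P} (e : M ≅ N) (I : PosetInterval P) :
    generalizedRank M I = generalizedRank N I :=
  limitColimitRank_congr (Functor.isoWhiskerLeft _ e) _

theorem generalizedRank_comap (N : PersistenceModule 𝔽 Q) (g : P →o Q) (I : PosetInterval P)
    (K : PosetInterval Q) (hIK : Set.MapsTo g I.carrier K.carrier)
    (hup : ∀ k ∈ K.carrier, {p ∈ I.carrier | k ≤ g p}.Nonempty)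
    (hupc : ∀ k ∈ K.carrier, IsZigzagConnected {p ∈ I.carrier | k ≤ g p})
    (hdn : ∀ k ∈ K.carrier, {p ∈ I.carrier | g p ≤ k}.Nonempty)
    (hdnc : ∀ k ∈ K.carrier, IsZigzagConnected {p ∈ I.carrier | g p ≤ k}) :
    generalizedRank (N.comap g) I = generalizedRank N K := by
  let r : I.carrier → K.carrier := hIK.restrict
  have hr : Monotone r := fun _ _ h => g.monotone h
  have hfinal : hr.functor.Final := final_functor_of_isZigzagConnected hr
    (fun k => (hup k k.2).elim fun p hp => ⟨⟨p, hp.1⟩, hp.2⟩) fun k => (hupc k k.2).setOf_coe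
  have hinitial : hr.functor.Initial := initial_functor_of_isZigzagConnected hr
    (fun k => (hdn k k.2).elim fun p hp => ⟨⟨p, hp.1⟩, hp.2⟩) fun k => (hdnc k k.2).setOf_coe
  obtain ⟨p, hp⟩ := I.nonempty
  rw [generalizedRank_eq _ I ⟨p, hp⟩, generalizedRank_eq _ K (r ⟨p, hp⟩)]
  exact limitColimitRank_comp hr.functor (N.restrict K.carrier) ⟨p, hp⟩

end Rank

/-! ### Existence and uniqueness of generalized persistence diagrams -/

section Moebius

variable {ι G : Type*} [PartialOrder ι] [AddCommGroup G]

theorem eq_zero_of_finsum_Ici_eq_zero {h : ι → G}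
    (hfin : ∀ i, (Set.Ici i ∩ Function.support h).Finite) (hsum : ∀ i, ∑ᶠ j ∈ Set.Ici i, h j = 0) :
    h = 0 := by
  by_contra hne
  obtain ⟨i, hi⟩ := Function.ne_iff.1 hne
  obtain ⟨k, ⟨hik, hk⟩, hmax⟩ := (hfin i).exists_maximal ⟨i, Set.self_mem_Ici, hi⟩
  have hsupp : Set.Ici k ∩ Function.support h = {k} :=
    Set.eq_singleton_iff_unique_mem.2 ⟨⟨Set.self_mem_Ici, hk⟩, fun l hl =>
      (hmax ⟨hik.trans hl.1, hl.2⟩ hl.1).antisymm hl.1⟩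
  apply hk
  rw [← hsum k, ← finsum_mem_inter_support, hsupp, finsum_mem_singleton]

theorem eq_of_finsum_Ici_eq {f g : ι → G} (hf : ∀ i, (Set.Ici i ∩ Function.support f).Finite)
    (hg : ∀ i, (Set.Ici i ∩ Function.support g).Finite)
    (h : ∀ i, ∑ᶠ j ∈ Set.Ici i, f j = ∑ᶠ j ∈ Set.Ici i, g j) : f = g := by
  refine sub_eq_zero.1 (eq_zero_of_finsum_Ici_eq_zero (fun i => ?_) fun i => ?_)
  · refine ((hf i).union (hg i)).subset ?_
    rw [← Set.inter_union_distrib_left]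
    exact Set.inter_subset_inter_right _ (Function.support_sub f g)
  · have hg' : (Set.Ici i ∩ Function.support (-g)).Finite := by
      rw [Function.support_neg]
      exact hg i
    calc ∑ᶠ j ∈ Set.Ici i, (f - g) j = ∑ᶠ j ∈ Set.Ici i, (f j + (-g) j) := by
          simp only [Pi.sub_apply, Pi.neg_apply, sub_eq_add_neg]
      _ = 0 := by
          rw [finsum_mem_add_distrib' (hf i) hg', h i]
          simp only [Pi.neg_apply, finsum_neg_distrib, add_neg_cancel]

theorem exists_finsum_Ici_eq [Finite ι] (r : ι → G) :
    ∃ g : ι → G, ∀ i, ∑ᶠ j ∈ Set.Ici i, g j = r i := by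
  have wf : WellFounded (fun x y : ι => y < x) := Finite.to_wellFoundedGT.wf
  let g : ι → G := wf.fix fun i ih => r i - ∑ᶠ j : Set.Ioi i, ih j.1 j.2
  have hg : ∀ i, g i = r i - ∑ᶠ j ∈ Set.Ioi i, g j := fun i => by
    rw [← finsum_set_coe_eq_finsum_mem]
    exact wf.fix_eq _ i
  refine ⟨g, fun i => ?_⟩
  rw [← Set.Ioi_insert, finsum_mem_insert _ Set.self_notMem_Ioi (Set.toFinite _), hg i,
    sub_add_cancel]

end Moebius

section Diagram

variable {𝔽 : Type u} [Field 𝔽] {P : Type} [PartialOrder P]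

theorem PosetInterval.carrier_injective :
    Function.Injective (PosetInterval.carrier : PosetInterval P → Set P) := by
  rintro ⟨I, _, _, _⟩ ⟨J, _, _, _⟩ h
  cases h
  rfl

/-- Intervals are ordered by inclusion, so that the sum defining a generalized persistence diagram
is a sum over `Set.Ici I`. -/
instance : PartialOrder (PosetInterval P) :=
  PartialOrder.lift PosetInterval.carrier PosetInterval.carrier_injective

instance [Finite P] : Finite (PosetInterval P) :=
  .of_injective _ PosetInterval.carrier_injective

theorem isGPD_iff {M : PersistenceModule 𝔽 P} {f : PosetInterval P → ℤ} :
    IsGPD M f ↔ ∀ I, (Set.Ici I ∩ Function.support f).Finite ∧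
      (generalizedRank M I : ℤ) = ∑ᶠ J ∈ Set.Ici I, f J :=
  Iff.rfl

variable {M : PersistenceModule 𝔽 P} {f f' : PosetInterval P → ℤ}

theorem IsGPD.unique (hf : IsGPD M f) (hf' : IsGPD M f') : f = f' :=
  eq_of_finsum_Ici_eq (fun I => (isGPD_iff.1 hf I).1) (fun I => (isGPD_iff.1 hf' I).1)
    fun I => (isGPD_iff.1 hf I).2.symm.trans (isGPD_iff.1 hf' I).2

theorem IsGPD.gpd_eq (hf : IsGPD M f) : gpd M = f :=
  (Classical.epsilon_spec (p := IsGPD M) ⟨f, hf⟩).unique hf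

theorem IsGPD.hasFiniteGPD (hf : IsGPD M f) (hs : (Function.support f).Finite) :
    HasFiniteGPD M :=
  ⟨⟨f, hf, fun _ h => h.unique hf⟩, hf.gpd_eq ▸ hs⟩

theorem HasFiniteGPD.isGPD (h : HasFiniteGPD M) : IsGPD M (gpd M) :=
  Classical.epsilon_spec h.1.exists

theorem exists_isGPD_of_finite [Finite P] (M : PersistenceModule 𝔽 P) : ∃ f, IsGPD M f := by
  obtain ⟨f, hf⟩ := exists_finsum_Ici_eq fun I : PosetInterval P => (generalizedRank M I : ℤ)
  exact ⟨f, isGPD_iff.2 fun I => ⟨Set.toFinite _, (hf I).symm⟩⟩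

theorem hasFiniteGPD_of_finite [Finite P] (M : PersistenceModule 𝔽 P) : HasFiniteGPD M :=
  (exists_isGPD_of_finite M).elim fun _ hf => hf.hasFiniteGPD (Set.toFinite _)

end Diagram

/-! ### Lattice homomorphisms out of a product of two chains -/

theorem isSublattice_Ici {M : Type*} [Lattice M] (k : M) : IsSublattice (Set.Ici k) :=
  ⟨fun _ ha _ _ => le_sup_of_le_left ha, fun _ ha _ hb => le_inf ha hb⟩

theorem isSublattice_Iic {M : Type*} [Lattice M] (k : M) : IsSublattice (Set.Iic k) :=
  ⟨fun _ ha _ hb => sup_le ha hb, fun _ ha _ _ => inf_le_of_left_le ha⟩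

theorem isSublattice_Icc {M : Type*} [Lattice M] (k l : M) : IsSublattice (Set.Icc k l) :=
  (isSublattice_Ici k).inter (isSublattice_Iic l)

section ProductOfChains

theorem exists_le_median_and_median_le {α β : Type*} [LinearOrder α] [LinearOrder β]
    (p q x : α × β) :
    (∃ y ∈ ({p, q, x} : Set (α × β)), y ≤ p ⊓ q ⊔ x ⊓ (p ⊔ q)) ∧
      ∃ z ∈ ({p, q, x} : Set (α × β)), p ⊓ q ⊔ x ⊓ (p ⊔ q) ≤ z := by
  obtain ⟨p₁, p₂⟩ := p
  obtain ⟨q₁, q₂⟩ := q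
  obtain ⟨x₁, x₂⟩ := x
  simp only [Set.mem_insert_iff, Set.mem_singleton_iff, exists_eq_or_imp, exists_eq_left,
    Prod.mk_inf_mk, Prod.mk_sup_mk, Prod.mk_le_mk]
  grind

theorem inf_sup_le_sup_or {α β : Type*} [LinearOrder α] [LinearOrder β] {p q : α × β}
    (hpq : ¬ p ≤ q) (x y : α × β) : x ⊓ (p ⊔ q) ≤ y ⊔ p ∨ y ⊓ (p ⊔ q) ≤ x ⊔ p := by
  obtain ⟨p₁, p₂⟩ := p
  obtain ⟨q₁, q₂⟩ := q
  obtain ⟨x₁, x₂⟩ := x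
  obtain ⟨y₁, y₂⟩ := y
  simp only [Prod.mk_inf_mk, Prod.mk_sup_mk, Prod.mk_le_mk] at hpq ⊢
  grind

variable {α β : Type} [LinearOrder α] [LinearOrder β]

theorem PosetInterval.isZigzagConnected_inter (I : PosetInterval (α × β)) {U : Set (α × β)}
    (hU : IsSublattice U) (hUc : U.OrdConnected) : IsZigzagConnected (I.carrier ∩ U) := by
  rintro ⟨p, hpI, hpU⟩ ⟨q, hqI, hqU⟩
  -- The median with `p` and `q` retracts `I` onto `I ∩ Set.Icc (p ⊓ q) (p ⊔ q) ⊆ I ∩ U`.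
  let median : α × β → α × β := fun x => p ⊓ q ⊔ x ⊓ (p ⊔ q)
  have hmono : Monotone median := fun x y h => sup_le_sup_left (inf_le_inf_right _ h) _
  have hmemI : ∀ x ∈ I.carrier, median x ∈ I.carrier := fun x hx => by
    obtain ⟨⟨y, hy, hyx⟩, z, hz, hxz⟩ := exists_le_median_and_median_le p q x
    have hsub : ({p, q, x} : Set (α × β)) ⊆ I.carrier := by simp [Set.insert_subset_iff, *]
    exact I.convex.out (hsub hy) (hsub hz) ⟨hyx, hxz⟩
  have hmemU : ∀ x, median x ∈ U := fun x =>
    hUc.out (hU.infClosed hpU hqU) (hU.supClosed hpU hqU)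
      ⟨le_sup_left, sup_le (inf_le_left.trans le_sup_left) inf_le_right⟩
  have hp : median p = p := by simp [median]
  have hq : median q = q := by simp [median]
  let retract : I.carrier → ↥(I.carrier ∩ U) := fun x => ⟨median x, hmemI x x.2, hmemU x⟩
  have hpath : Relation.ReflTransGen (fun x y : ↥(I.carrier ∩ U) => x ≤ y ∨ y ≤ x)
      (retract ⟨p, hpI⟩) (retract ⟨q, hqI⟩) :=
    (I.connected ⟨p, hpI⟩ ⟨q, hqI⟩).lift retract fun _ _ => Or.imp (@hmono _ _) (@hmono _ _)
  simpa only [retract, hp, hq] using hpath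

section Image

variable {M : Type*} [Lattice M] (f : LatticeHom (α × β) M)

theorem PosetInterval.isZigzagConnected_inter_preimage (I : PosetInterval (α × β)) {T : Set M}
    (hT : IsSublattice T) (hTc : T.OrdConnected) : IsZigzagConnected (I.carrier ∩ f ⁻¹' T) :=
  I.isZigzagConnected_inter (hT.preimage f) (hTc.preimage_mono (OrderHomClass.mono f))

theorem PosetInterval.apply_mem_image_of_le (I : PosetInterval (α × β)) {p q y : α × β}
    (hp : p ∈ I.carrier) (hq : q ∈ I.carrier) (hpq : p ≤ q) (hpy : f p ≤ f y) (hyq : f y ≤ f q) :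
    f y ∈ f '' I.carrier := by
  refine ⟨p ⊔ y ⊓ q, I.convex.out hp hq ⟨le_sup_left, sup_le hpq inf_le_right⟩, ?_⟩
  rw [map_sup, map_inf, inf_eq_left.2 hyq, sup_eq_right.2 hpy]

theorem apply_le_apply_or_of_not_le {p q x y : α × β} (hpq : ¬ p ≤ q)
    (hx : f x ∈ Set.Icc (f p) (f q)) (hy : f y ∈ Set.Icc (f p) (f q)) :
    f x ≤ f y ∨ f y ≤ f x := by
  refine (inf_sup_le_sup_or hpq x y).imp (fun h => ?_) fun h => ?_
  all_goals
    have hf := OrderHomClass.mono f h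
    rw [map_inf, map_sup, map_sup, sup_eq_right.2 (hx.1.trans hx.2)] at hf
  · rwa [inf_eq_left.2 hx.2, sup_eq_left.2 hy.1] at hf
  · rwa [inf_eq_left.2 hy.2, sup_eq_left.2 hx.1] at hf

variable {f}

theorem PosetInterval.ordConnected_image (I : PosetInterval (α × β))
    (hf : Function.Surjective f) : (f '' I.carrier).OrdConnected := by
  refine ⟨?_⟩
  rintro _ ⟨p, hp, rfl⟩ _ ⟨q, hq, rfl⟩ z hz
  obtain ⟨y, rfl⟩ := hf z
  by_cases hpq : p ≤ q
  · exact I.apply_mem_image_of_le f hp hq hpq hz.1 hz.2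
  by_contra hy
  -- Along a zigzag from `p` to `q` the image stays below `f y`, which it cannot jump over.
  have hpq' := hz.1.trans hz.2
  have hpath := I.isZigzagConnected_inter_preimage f (isSublattice_Icc (f p) (f q))
    Set.ordConnected_Icc
  let S : Set (α × β) := I.carrier ∩ f ⁻¹' Set.Icc (f p) (f q)
  let p' : S := ⟨p, hp, Set.left_mem_Icc.2 hpq'⟩
  let q' : S := ⟨q, hq, Set.right_mem_Icc.2 hpq'⟩
  suffices hbelow : ∀ x : S,
      Relation.ReflTransGen (fun x y => x ≤ y ∨ y ≤ x) p' x → f x.1 ≤ f y from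
    hy ⟨q, hq, (hbelow q' (hpath p' q')).antisymm hz.2⟩
  intro x hx
  induction hx with
  | refl => exact hz.1
  | @tail x x' _ hxx' ih =>
    rcases hxx' with hle | hle
    · refine (apply_le_apply_or_of_not_le f hpq x'.2.2 hz).resolve_right fun h => hy ?_
      exact I.apply_mem_image_of_le f x.2.1 x'.2.1 hle ih h
    · exact (OrderHomClass.mono f (Subtype.coe_le_coe.2 hle)).trans ih

end Image

variable {M : Type} [Lattice M] {f : LatticeHom (α × β) M}

/-- The image of an interval under a surjective lattice homomorphism. Only for a product of two
chains is the image convex in general. -/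
def PosetInterval.map (hf : Function.Surjective f) (I : PosetInterval (α × β)) :
    PosetInterval M where
  carrier := f '' I.carrier
  nonempty := I.nonempty.image f
  convex := I.ordConnected_image hf
  connected := IsZigzagConnected.of_surjective I.connected (f := fun x => ⟨f x, x, x.2, rfl⟩)
    (fun _ _ h => OrderHomClass.mono f h) fun ⟨_, x, hx, hfx⟩ => ⟨⟨x, hx⟩, Subtype.ext hfx⟩

end ProductOfChains

/-- The preimage of an interval under a surjective lattice homomorphism. -/
def PosetInterval.comap {L M : Type} [Lattice L] [Lattice M] {f : LatticeHom L M}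
    (hf : Function.Surjective f) (K : PosetInterval M) : PosetInterval L where
  carrier := f ⁻¹' K.carrier
  nonempty := K.nonempty.preimage hf
  convex := K.convex.preimage_mono (OrderHomClass.mono f)
  connected := by
    have hjoin : ∀ p q : f ⁻¹' K.carrier, f p ≤ f q ∨ f q ≤ f p →
        Relation.ReflTransGen (fun x y : f ⁻¹' K.carrier => x ≤ y ∨ y ≤ x) p q := by
      intro p q h
      have hmem : (p ⊔ q : L) ∈ f ⁻¹' K.carrier := by
        rw [Set.mem_preimage, map_sup]
        exact h.elim (fun h => (sup_eq_right.2 h).symm ▸ q.2) fun h => (sup_eq_left.2 h).symm ▸ p.2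
      exact .tail (b := ⟨p ⊔ q, hmem⟩) (.single (.inl le_sup_left)) (.inr le_sup_right)
    intro p q
    let rightInv : K.carrier → f ⁻¹' K.carrier := fun k =>
      ⟨Function.surjInv hf k, by rw [Set.mem_preimage, Function.surjInv_eq hf]; exact k.2⟩
    have hrightInv : ∀ k, f (rightInv k) = k := fun k => Function.surjInv_eq hf k
    have hpath := (K.connected ⟨f p, p.2⟩ ⟨f q, q.2⟩).lift' rightInv fun k l h =>
      hjoin _ _ (by rwa [hrightInv, hrightInv])
    exact ((hjoin p _ (.inl (hrightInv ⟨f p, p.2⟩).ge)).trans hpath).trans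
      (hjoin _ q (.inl (hrightInv ⟨f q, q.2⟩).le))

section Pullback

variable {𝔽 : Type u} [Field 𝔽] {α β M : Type} [LinearOrder α] [LinearOrder β] [Lattice M]
  {f : LatticeHom (α × β) M}

theorem generalizedRank_comap_latticeHom (N : PersistenceModule 𝔽 M) (hf : Function.Surjective f)
    (I : PosetInterval (α × β)) :
    generalizedRank (N.comap (f : α × β →o M)) I = generalizedRank N (I.map hf) := by
  refine generalizedRank_comap N _ I _ (Set.mapsTo_image f I.carrier) ?_ (fun k _ => ?_) ?_
    fun k _ => ?_
  · rintro _ ⟨p, hp, rfl⟩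
    exact ⟨p, hp, le_rfl⟩
  · exact I.isZigzagConnected_inter_preimage f (isSublattice_Ici k) Set.ordConnected_Ici
  · rintro _ ⟨p, hp, rfl⟩
    exact ⟨p, hp, le_rfl⟩
  · exact I.isZigzagConnected_inter_preimage f (isSublattice_Iic k) Set.ordConnected_Iic

theorem PosetInterval.comap_injective (hf : Function.Surjective f) :
    Function.Injective (PosetInterval.comap hf) := fun _ _ h =>
  PosetInterval.carrier_injective (hf.preimage_injective (congrArg PosetInterval.carrier h))

theorem hasFiniteGPD_comap_latticeHom [Finite M] (N : PersistenceModule 𝔽 M)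
    (hf : Function.Surjective f) : HasFiniteGPD (N.comap (f : α × β →o M)) := by
  obtain ⟨g, hg⟩ := exists_isGPD_of_finite N
  have hinj := PosetInterval.comap_injective hf
  -- The diagram of the pullback is supported on preimages of intervals.
  let g' : PosetInterval (α × β) → ℤ := Function.extend (PosetInterval.comap hf) g 0
  have hsupp : Function.support g' ⊆ Set.range (PosetInterval.comap hf) := fun J hJ => by
    by_contra h
    exact hJ (Function.extend_apply' g (0 : PosetInterval (α × β) → ℤ) J h)
  have hfin : (Function.support g').Finite := (Set.finite_range _).subset hsupp
  refine IsGPD.hasFiniteGPD (isGPD_iff.2 fun I => ⟨hfin.inter_of_right _, ?_⟩) hfin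
  have hIci : Set.Ici I ∩ Function.support g' =
      PosetInterval.comap hf '' Set.Ici (I.map hf) ∩ Function.support g' := by
    refine Set.ext fun J => and_congr_left fun hJ => ?_
    obtain ⟨K, rfl⟩ := hsupp hJ
    rw [hinj.mem_set_image]
    exact Set.image_subset_iff.symm
  rw [generalizedRank_comap_latticeHom N hf, (isGPD_iff.1 hg _).2,
    finsum_mem_inter_support_eq _ _ _ hIci, finsum_mem_image hinj.injOn]
  exact finsum_mem_congr rfl fun K _ => (hinj.extend_apply g 0 K).symm

end Pullback

/-! ### Finiteness of the diagrams of the sublevel-Rips and sublevel-Čech bifiltrations -/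

section Finiteness

theorem exists_orderHom_finite_range_comp_eq {α A : Type*} [LinearOrder α] [PartialOrder A]
    (φ : α →o A) (hφ : (Set.range φ).Finite) :
    ∃ r : α →o α, (Set.range r).Finite ∧ ∀ x, φ (r x) = φ x := by
  choose s hs using fun a : Set.range φ => a.2
  have : Finite (Set.range φ) := hφ
  refine ⟨⟨fun x => s ⟨φ x, x, rfl⟩, fun x y hxy => ?_⟩, ?_, fun x => hs _⟩
  · by_contra! hlt
    have hle : φ y ≤ φ x := by simpa only [hs] using φ.monotone hlt.le
    exact hlt.ne (congrArg s (Subtype.ext (hle.antisymm (φ.monotone hxy))))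
  · exact (Set.finite_range s).subset (Set.range_comp_subset_range _ s)

variable (𝔽 : Type u) [Field 𝔽]

/-- The homomorphism of lattices given by two monotone maps of chains. -/
def prodLatticeHom {α β A B : Type*} [LinearOrder α] [LinearOrder β] [LinearOrder A]
    [LinearOrder B] (φ : α →o A) (ψ : β →o B) : LatticeHom (α × β) (A × B) where
  toFun := Prod.map φ ψ
  map_sup' _ _ := Prod.ext (φ.monotone.map_sup _ _) (ψ.monotone.map_sup _ _)
  map_inf' _ _ := Prod.ext (φ.monotone.map_inf _ _) (ψ.monotone.map_inf _ _)

theorem hasFiniteGPD_persistentHomology {α β A B V : Type} [LinearOrder α] [LinearOrder β]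
    [PartialOrder A] [PartialOrder B] (φ : α →o A) (ψ : β →o B) (hφ : (Set.range φ).Finite)
    (hψ : (Set.range ψ).Finite) (F : α × β →o PreAbstractSimplicialComplex V)
    (hF : ∀ p q : α × β, φ p.1 = φ q.1 → ψ p.2 = ψ q.2 → F p = F q) (m : ℕ) :
    HasFiniteGPD (persistentHomology 𝔽 F m) := by
  obtain ⟨r, hr, hφr⟩ := exists_orderHom_finite_range_comp_eq φ hφ
  obtain ⟨s, hs, hψs⟩ := exists_orderHom_finite_range_comp_eq ψ hψ
  have : Finite (Set.range r) := hr
  have : Finite (Set.range s) := hs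
  let r' : α →o Set.range r := ⟨Set.rangeFactorization r, fun _ _ h => r.monotone h⟩
  let s' : β →o Set.range s := ⟨Set.rangeFactorization s, fun _ _ h => s.monotone h⟩
  have hsurj : Function.Surjective (prodLatticeHom r' s') :=
    Set.rangeFactorization_surjective.prodMap Set.rangeFactorization_surjective
  let F' : Set.range r × Set.range s →o PreAbstractSimplicialComplex V :=
    F.comp ((OrderHom.Subtype.val _).prodMap (OrderHom.Subtype.val _))
  have hFF' : F = F'.comp (prodLatticeHom r' s' : α × β →o _) :=
    OrderHom.ext _ _ (funext fun p => hF _ _ (hφr _).symm (hψs _).symm)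
  rw [hFF']
  exact hasFiniteGPD_comap_latticeHom (persistentHomology 𝔽 F' m) hsurj

/-- The sublevel sets of `γ`, as a monotone function of the level. -/
def sublevel {X : Type*} (γ : X → ℝ) : ℝ →o Set X :=
  ⟨fun a => γ ⁻¹' Set.Iic a, fun _ _ h _ hx => le_trans hx h⟩

variable {𝔽}

theorem hasFiniteGPD_sublevelRips {X : Type} [MetricSpace X] [Finite X] (γ : X → ℝ) (m : ℕ) :
    HasFiniteGPD (persistentHomology 𝔽 (sublevelRips γ) m) := by
  let close : ℝ≥0 →o Set (X × X) := ⟨fun r => {p | dist p.1 p.2 ≤ r},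
    fun r s h p hp => le_trans (Set.mem_ofPred.1 hp) (NNReal.coe_le_coe.2 h)⟩
  refine hasFiniteGPD_persistentHomology 𝔽 (sublevel γ) close (Set.toFinite _) (Set.toFinite _) _
    (fun p q hsub hclose => ?_) m
  have hdist : ∀ x y, dist x y ≤ p.2 ↔ dist x y ≤ q.2 := fun x y => Set.ext_iff.1 hclose (x, y)
  change ripsComplex (sublevel γ p.1) p.2 = ripsComplex (sublevel γ q.1) q.2
  rw [hsub]
  ext s
  simp only [ripsComplex, hdist]

theorem hasFiniteGPD_sublevelCech {E : Type} [MetricSpace E] {X : Set E} [Finite X]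
    (γ : X → ℝ) (m : ℕ) : HasFiniteGPD (persistentHomology 𝔽 (sublevelCech γ) m) := by
  let meet : ℝ≥0 →o Set (Finset X) :=
    ⟨fun r => {s | (⋂ x ∈ s, Metric.closedBall (x : E) (r : ℝ)).Nonempty},
    fun r t h s hs => Set.Nonempty.mono (Set.iInter₂_mono fun x _ =>
      Metric.closedBall_subset_closedBall (NNReal.coe_le_coe.2 h)) hs⟩
  refine hasFiniteGPD_persistentHomology 𝔽 (sublevel γ) meet (Set.toFinite _) (Set.toFinite _) _
    (fun p q hsub hmeet => ?_) m
  have hballs : ∀ s : Finset X, (⋂ x ∈ s, Metric.closedBall (x : E) (p.2 : ℝ)).Nonempty ↔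
      (⋂ x ∈ s, Metric.closedBall (x : E) (q.2 : ℝ)).Nonempty := Set.ext_iff.1 hmeet
  change cechComplex (sublevel γ p.1) p.2 = cechComplex (sublevel γ q.1) q.2
  rw [hsub]
  ext s
  simp only [cechComplex, hballs]

end Finiteness

/-! ### Intervals of the grid indexed by subsets of the antidiagonal -/

namespace PosetInterval

variable {P Q : Type} [PartialOrder P] [PartialOrder Q]

/-- A convex set with a greatest element, as an interval. -/
def ofIsGreatest {S : Set P} {t : P} (hS : S.OrdConnected) (ht : IsGreatest S t) :
    PosetInterval P where
  carrier := S
  nonempty := ht.nonempty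
  convex := hS
  connected := isZigzagConnected_of_directedOn fun _ hp _ hq => ⟨t, ht.1, ht.2 hp, ht.2 hq⟩

variable [OrderTop Q]

/-- An upper set of a poset with a greatest element, as an interval. -/
def ofUpperSet (U : UpperSet Q) (hU : ⊤ ∈ U) : PosetInterval Q :=
  ofIsGreatest (S := U) U.upper.ordConnected ⟨hU, fun _ _ => le_top⟩

/-- The convex hull of the image of an upper set under a monotone map. -/
def hull (ι : Q →o P) (U : UpperSet Q) (hU : ⊤ ∈ U) : PosetInterval P :=
  ofIsGreatest (S := {x | (∃ k ∈ U, ι k ≤ x) ∧ x ≤ ι ⊤})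
    ⟨fun _ ⟨⟨k, hk, hkx⟩, _⟩ _ ⟨_, hy⟩ _ hz => ⟨⟨k, hk, hkx.trans hz.1⟩, hz.2.trans hy⟩⟩
    ⟨⟨⟨⊤, hU, le_rfl⟩, le_rfl⟩, fun _ hx => hx.2⟩

theorem apply_mem_hull (ι : Q →o P) {U : UpperSet Q} (hU : ⊤ ∈ U) {p : Q} (hp : p ∈ U) :
    ι p ∈ (hull ι U hU).carrier :=
  ⟨⟨p, hp, le_rfl⟩, ι.monotone le_top⟩

theorem hull_le_iff (ι : Q →o P) {U : UpperSet Q} (hU : ⊤ ∈ U) {J : PosetInterval P} :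
    hull ι U hU ≤ J ↔ ∀ p ∈ U, ι p ∈ J.carrier := by
  refine ⟨fun h p hp => h (apply_mem_hull ι hU hp), fun h x ⟨⟨k, hk, hkx⟩, hx⟩ => ?_⟩
  exact J.convex.out (h k hk) (h ⊤ hU) ⟨hkx, hx⟩

end PosetInterval

theorem generalizedRank_hull {𝔽 : Type u} [Field 𝔽] {P Q : Type} [SemilatticeSup P]
    [SemilatticeSup Q] [OrderTop Q] (M : PersistenceModule 𝔽 P) {ι : Q →o P}
    (hι : ∀ p q, ι (p ⊔ q) = ι p ⊔ ι q) (U : UpperSet Q) (hU : ⊤ ∈ U) :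
    generalizedRank M (.hull ι U hU) = generalizedRank (M.comap ι) (.ofUpperSet U hU) := by
  refine (generalizedRank_comap M ι _ _ (fun p hp => PosetInterval.apply_mem_hull ι hU hp)
    (fun k hk => ⟨⊤, hU, hk.2⟩) (fun k hk => ?_) (fun k ⟨⟨p, hp, hpk⟩, _⟩ => ⟨p, hp, hpk⟩)
    fun k _ => ?_).symm
  · exact isZigzagConnected_of_directedOn fun _ _ _ _ => ⟨⊤, ⟨hU, hk.2⟩, le_top, le_top⟩
  · refine isZigzagConnected_of_directedOn fun p hp q hq => ⟨p ⊔ q, ⟨?_, ?_⟩, le_sup_left,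
      le_sup_right⟩
    · exact U.upper le_sup_left hp.1
    · exact (hι p q).le.trans (sup_le hp.2 hq.2)

section Staircase

variable {n : ℕ}

/-- The points of the grid above the antidiagonal, together with the points `(i, n - i)` of the
antidiagonal for `i ∈ S`. -/
def staircase (S : Finset (Fin (n + 1))) : UpperSet (Fin (n + 1) × Fin (n + 1)) where
  carrier := {p | n < (p.1 : ℕ) + p.2 ∨ ((p.1 : ℕ) + p.2 = n ∧ p.1 ∈ S)}
  upper' := by
    rintro ⟨a, b⟩ ⟨c, d⟩ ⟨hac, hbd⟩ h
    simp only [Fin.le_def] at hac hbd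
    rcases h with h | ⟨h, hS⟩
    · exact Or.inl (by dsimp only at h ⊢; omega)
    by_cases heq : a = c
    · subst heq
      dsimp only at h hS ⊢
      exact (show n ≤ (a : ℕ) + d by omega).lt_or_eq.imp_right fun h => ⟨h.symm, hS⟩
    · exact Or.inl (by dsimp only at h ⊢; omega)

theorem top_mem_staircase (hn : 0 < n) (S : Finset (Fin (n + 1))) : ⊤ ∈ staircase S :=
  Or.inl (by simp [hn])

theorem mem_staircase_iff {S : Finset (Fin (n + 1))} {p : Fin (n + 1) × Fin (n + 1)} :
    p ∈ staircase S ↔ p ∈ staircase (∅ : Finset (Fin (n + 1))) ∨ ∃ i ∈ S, p = (i, i.rev) := by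
  obtain ⟨a, b⟩ := p
  have hrev : b = a.rev ↔ (a : ℕ) + b = n := by rw [Fin.ext_iff, Fin.val_rev]; omega
  change _ ∨ _ ↔ (_ ∨ _) ∨ _
  simp [Prod.ext_iff, hrev, and_comm]

theorem hull_staircase_le_iff {P : Type} [PartialOrder P] (ι : Fin (n + 1) × Fin (n + 1) →o P)
    (hn : 0 < n) (S : Finset (Fin (n + 1))) (J : PosetInterval P) :
    .hull ι (staircase S) (top_mem_staircase hn S) ≤ J ↔
      .hull ι (staircase ∅) (top_mem_staircase hn ∅) ≤ J ∧ ∀ i ∈ S, ι (i, i.rev) ∈ J.carrier := by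
  simp only [PosetInterval.hull_le_iff, mem_staircase_iff (S := S), or_imp, forall_and,
    forall_exists_index, and_imp]
  grind

end Staircase

/-! ### The lower bound on the size of the diagram -/

section Counting

variable {E : Type} [Fintype E] [DecidableEq E]

theorem sum_Ici_neg_one_pow_card_compl (S : Finset E) :
    ∑ T ∈ Finset.Ici S, (-1 : ℤ) ^ Tᶜ.card = if S = Finset.univ then 1 else 0 := by
  rw [Finset.sum_bijective (t := Sᶜ.powerset) (g := fun U => (-1 : ℤ) ^ U.card) compl
    compl_bijective (by simp) fun _ _ => rfl, Finset.sum_powerset_neg_one_pow_card]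
  simp only [Finset.compl_eq_empty_iff]

theorem ne_zero_of_sum_Ici_eq {h : Finset E → ℤ}
    (hsum : ∀ S, ∑ T ∈ Finset.Ici S, h T = if S = Finset.univ then 0 else 1) {S : Finset E}
    (hS : S ≠ Finset.univ) : h S ≠ 0 := by
  have hh : h = fun T => (if T = Finset.univ then 1 else 0) - (-1) ^ Tᶜ.card := by
    refine eq_of_finsum_Ici_eq (fun _ => Set.toFinite _) (fun _ => Set.toFinite _) fun S => ?_
    rw [← Finset.coe_Ici, finsum_mem_coe_finset, finsum_mem_coe_finset, hsum,
      Finset.sum_sub_distrib, sum_Ici_neg_one_pow_card_compl, Finset.sum_ite_eq',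
      if_pos (Finset.mem_Ici.2 (Finset.subset_univ S))]
    split_ifs <;> rfl
  rw [hh]
  simp [hS]

variable {𝔽 : Type u} [Field 𝔽] {P : Type} [PartialOrder P] {M : PersistenceModule 𝔽 P}
  {f : PosetInterval P → ℤ}

open Classical in
theorem IsGPD.generalizedRank_eq_sum (hf : IsGPD M f) {I₀ I : PosetInterval P} (hI : I₀ ≤ I) :
    (generalizedRank M I : ℤ) = ∑ J ∈ (hf I₀).1.toFinset with I ≤ J, f J := by
  rw [(isGPD_iff.1 hf I).2, ← finsum_mem_coe_finset]
  refine finsum_mem_inter_support_eq _ _ _ (Set.ext fun J => and_congr_left fun hJ => ?_)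
  simp only [Finset.coe_filter, Set.Finite.mem_toFinset]
  exact ⟨fun h => ⟨⟨hI.trans h, hJ⟩, h⟩, fun h => h.2⟩

theorem IsGPD.two_pow_sub_one_le_encard_support (hf : IsGPD M f) (I : Finset E → PosetInterval P)
    (p : E → P) (hI : ∀ S J, I S ≤ J ↔ I ∅ ≤ J ∧ ∀ i ∈ S, p i ∈ J.carrier)
    (hr : ∀ S, generalizedRank M (I S) = if S = Finset.univ then 0 else 1) :
    (2 ^ Fintype.card E - 1 : ℕ) ≤ (Function.support f).encard := by
  classical
  set s : Finset (PosetInterval P) := (hf (I ∅)).1.toFinset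
  have hs : ∀ J ∈ s, I ∅ ≤ J ∧ f J ≠ 0 := fun J => (Set.Finite.mem_toFinset _).1
  -- The pushforward `h` of `f` along `trace` has superset sums `1, …, 1, 0`.
  let trace : PosetInterval P → Finset E := fun J => {i | p i ∈ J.carrier}
  let h : Finset E → ℤ := fun T => ∑ J ∈ s with trace J = T, f J
  have hsum : ∀ S, ∑ T ∈ Finset.Ici S, h T = if S = Finset.univ then 0 else 1 := fun S => by
    have htrace : ∀ J ∈ s, trace J ∈ Finset.Ici S ↔ I S ≤ J := fun J hJ => by
      rw [hI, and_iff_right (hs J hJ).1]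
      simp [trace, Finset.subset_iff]
    rw [Finset.sum_fiberwise_eq_sum_filter, Finset.filter_congr htrace,
      ← hf.generalizedRank_eq_sum ((hI S _).1 le_rfl).1, hr]
    split_ifs <;> rfl
  have himage : (Finset.univ.erase Finset.univ : Finset (Finset E)) ⊆ s.image trace := by
    intro S hS
    obtain ⟨J, hJ, -⟩ := Finset.exists_ne_zero_of_sum_ne_zero
      (ne_zero_of_sum_Ici_eq hsum (Finset.ne_of_mem_erase hS))
    exact Finset.mem_image.2 ⟨J, Finset.mem_filter.1 hJ⟩
  calc ((2 ^ Fintype.card E - 1 : ℕ) : ℕ∞)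
      = (Finset.univ.erase Finset.univ : Finset (Finset E)).card := by
        rw [Finset.card_erase_of_mem (Finset.mem_univ _), Finset.card_univ, Fintype.card_finset]
    _ ≤ s.card := by exact_mod_cast (Finset.card_le_card himage).trans Finset.card_image_le
    _ = (s : Set (PosetInterval P)).encard := (Set.encard_coe_eq_coe_finsetCard s).symm
    _ ≤ _ := Set.encard_le_encard fun J hJ => (hs J hJ).2

end Counting

/-! ### Oriented simplices -/

section Chains

variable (𝔽 : Type u) [Field 𝔽] {V : Type}

/-- The oriented simplex `[v₀, …, v_m]` as an alternating chain. -/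
noncomputable def orientedSimplex {m : ℕ} (v : Fin (m + 1) → V) : (Fin (m + 1) → V) →₀ 𝔽 :=
  ∑ σ : Equiv.Perm (Fin (m + 1)), Finsupp.single (v ∘ σ) ((Equiv.Perm.sign σ : ℤ) : 𝔽)

theorem orientedSimplex_comp_perm {m : ℕ} (v : Fin (m + 1) → V) (σ : Equiv.Perm (Fin (m + 1))) :
    orientedSimplex 𝔽 (v ∘ σ) = ((Equiv.Perm.sign σ : ℤ) : 𝔽) • orientedSimplex 𝔽 v := by
  simp only [orientedSimplex, Finset.smul_sum, Finsupp.smul_single, smul_eq_mul]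
  rw [← Equiv.sum_comp (Equiv.mulLeft σ) fun τ : Equiv.Perm _ => Finsupp.single (v ∘ τ) _]
  refine Finset.sum_congr rfl fun τ _ => ?_
  simp [Function.comp_assoc, ← mul_assoc, ← Int.cast_mul, ← Units.val_mul]

theorem exists_perm_of_orientedSimplex_apply_ne_zero {m : ℕ} {v w : Fin (m + 1) → V}
    (h : orientedSimplex 𝔽 v w ≠ 0) : ∃ σ : Equiv.Perm (Fin (m + 1)), v ∘ σ = w := by
  rw [orientedSimplex, Finsupp.finsetSum_apply] at h
  obtain ⟨σ, -, hσ⟩ := Finset.exists_ne_zero_of_sum_ne_zero h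
  exact ⟨σ, by_contra fun hne => hσ (Finsupp.single_eq_of_ne' hne)⟩

theorem orientedSimplex_apply_self {m : ℕ} {v : Fin (m + 1) → V} (hv : Function.Injective v) :
    orientedSimplex 𝔽 v v = 1 := by
  rw [orientedSimplex, Finsupp.finsetSum_apply, Finset.sum_eq_single 1]
  · simp
  · refine fun σ _ hσ => Finsupp.single_eq_of_ne' fun h => hσ (Equiv.ext fun i => ?_)
    exact hv (congrFun h i)
  · simp

theorem orientedSimplex_mem_chains {K : PreAbstractSimplicialComplex V} {m : ℕ}
    {v : Fin (m + 1) → V} (hv : Function.Injective v) {s : Finset V} (hs : s ∈ K.faces)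
    (hsv : (s : Set V) = Set.range v) : orientedSimplex 𝔽 v ∈ simplicialChains 𝔽 K m := by
  refine ⟨fun w hw => ?_, fun τ w => ?_⟩
  · obtain ⟨σ, rfl⟩ := exists_perm_of_orientedSimplex_apply_ne_zero 𝔽 hw
    exact ⟨hv.comp σ.injective, s, hs, by rw [hsv, σ.surjective.range_comp]⟩
  · classical
    simp only [orientedSimplex, Finsupp.finsetSum_apply, Finset.mul_sum]
    rw [← Equiv.sum_comp (Equiv.mulRight τ)]
    refine Finset.sum_congr rfl fun σ _ => ?_
    have hcancel : v ∘ (σ * τ : Equiv.Perm _) = w ∘ τ ↔ v ∘ σ = w := by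
      rw [Equiv.Perm.coe_mul, ← Function.comp_assoc]
      exact τ.surjective.injective_comp_right.eq_iff
    simp only [Finsupp.single_apply, Equiv.coe_mulRight, hcancel, Equiv.Perm.sign_mul]
    split_ifs
    · push_cast
      ring
    · rw [mul_zero]

theorem simplicialBoundary_orientedSimplex {m : ℕ} (v : Fin (m + 2) → V) :
    simplicialBoundary 𝔽 V (m + 1) (orientedSimplex 𝔽 v) =
      ∑ i : Fin (m + 2), (-1 : 𝔽) ^ (i : ℕ) • orientedSimplex 𝔽 (v ∘ i.succAbove) := by
  rw [orientedSimplex, map_sum, ← Equiv.Perm.decomposeFin.symm.sum_comp, Fintype.sum_prod_type]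
  refine Finset.sum_congr rfl fun i _ => ?_
  have hsingle : ∀ w (x : 𝔽), simplicialBoundary 𝔽 V (m + 1) (Finsupp.single w x) =
      Finsupp.single (Fin.tail w) x := fun _ _ => Finsupp.mapDomain_single
  simp only [hsingle, Equiv.Perm.decomposeFin.symm_sign]
  cases i using Fin.cases with
  | zero =>
    have htail : ∀ σ : Equiv.Perm (Fin (m + 1)),
        Fin.tail (v ∘ Equiv.Perm.decomposeFin.symm (0, σ)) = (v ∘ Fin.succAbove 0) ∘ σ :=
      fun σ => funext fun j => by simp [Fin.tail]
    simp [htail, orientedSimplex]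
  | succ i =>
    have htail : ∀ σ : Equiv.Perm (Fin (m + 1)),
        Fin.tail (v ∘ Equiv.Perm.decomposeFin.symm (i.succ, σ)) =
          ((v ∘ i.succ.succAbove) ∘ i.cycleRange) ∘ σ :=
      fun σ => funext fun j => by simp [Fin.tail, Fin.succAbove_cycleRange]
    have hsign : (-1 : 𝔽) ^ ((i.succ : Fin (m + 2)) : ℕ) =
        -((Equiv.Perm.sign i.cycleRange : ℤ) : 𝔽) := by
      simp [Fin.sign_cycleRange, pow_succ]
    rw [hsign, neg_smul, ← orientedSimplex_comp_perm, orientedSimplex, ← Finset.sum_neg_distrib]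
    simp [htail, Finsupp.single_neg]

theorem orientedSimplex_singleton (a : V) : orientedSimplex 𝔽 ![a] = Finsupp.single ![a] 1 := by
  simp [orientedSimplex]

theorem orientedSimplex_pair (a b : V) :
    orientedSimplex 𝔽 ![a, b] = Finsupp.single ![a, b] 1 - Finsupp.single ![b, a] 1 := by
  have hswap : ![a, b] ∘ Equiv.swap (0 : Fin 2) 1 = ![b, a] := by
    funext i
    fin_cases i <;> simp
  have huniv : (Finset.univ : Finset (Equiv.Perm (Fin 2))) = {1, Equiv.swap 0 1} := by decide
  rw [orientedSimplex, huniv, Finset.sum_pair (by decide), hswap]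
  simp [Finsupp.single_neg, sub_eq_add_neg]

theorem orientedSimplex_pair_swap (a b : V) :
    orientedSimplex 𝔽 ![a, b] = -orientedSimplex 𝔽 ![b, a] := by
  rw [orientedSimplex_pair, orientedSimplex_pair, neg_sub]

theorem simplicialBoundary_pair (a b : V) :
    simplicialBoundary 𝔽 V 1 (orientedSimplex 𝔽 ![a, b]) =
      Finsupp.single ![b] 1 - Finsupp.single ![a] 1 := by
  have hface : ![a, b] ∘ Fin.succAbove 0 = ![b] ∧ ![a, b] ∘ Fin.succAbove 1 = ![a] := by
    constructor <;> funext i <;> fin_cases i <;> rfl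
  rw [simplicialBoundary_orientedSimplex, Fin.sum_univ_two, hface.1, hface.2,
    orientedSimplex_singleton, orientedSimplex_singleton]
  simp [sub_eq_add_neg]

theorem simplicialBoundary_triple (a b c : V) :
    simplicialBoundary 𝔽 V 2 (orientedSimplex 𝔽 ![a, b, c]) =
      orientedSimplex 𝔽 ![a, b] + orientedSimplex 𝔽 ![b, c] + orientedSimplex 𝔽 ![c, a] := by
  have hface : ![a, b, c] ∘ Fin.succAbove 0 = ![b, c] ∧ ![a, b, c] ∘ Fin.succAbove 1 = ![a, c] ∧
      ![a, b, c] ∘ Fin.succAbove 2 = ![a, b] := by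
    refine ⟨?_, ?_, ?_⟩ <;> funext i <;> fin_cases i <;> rfl
  rw [simplicialBoundary_orientedSimplex, Fin.sum_univ_three, hface.1, hface.2.1, hface.2.2,
    orientedSimplex_pair_swap 𝔽 c a]
  simp only [Fin.val_zero, Fin.val_one, Fin.val_two, pow_zero, pow_one, one_smul, neg_smul,
    neg_one_sq]
  abel

variable {𝔽}

theorem mem_span_orientedSimplex {K : PreAbstractSimplicialComplex V} {m : ℕ}
    {c : (Fin (m + 1) → V) →₀ 𝔽} (hc : c ∈ simplicialChains 𝔽 K m) :
    c ∈ Submodule.span 𝔽 (orientedSimplex 𝔽 '' {v | c v ≠ 0}) := by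
  induction hk : c.support.card using Nat.strong_induction_on generalizing c with
  | _ k ih =>
    by_cases h0 : c = 0
    · rw [h0]
      exact zero_mem _
    obtain ⟨v, hv⟩ := Finsupp.ne_iff.1 h0
    obtain ⟨hinj, s, hs, hsv⟩ := hc.1 v hv
    -- Subtracting `c v • [v]` clears the coefficients of `c` at all orderings of `v`.
    obtain ⟨d, hd⟩ : ∃ d, d = c - c v • orientedSimplex 𝔽 v := ⟨_, rfl⟩
    have hdK : d ∈ simplicialChains 𝔽 K m :=
      hd ▸ sub_mem hc (Submodule.smul_mem _ _ (orientedSimplex_mem_chains 𝔽 hinj hs hsv))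
    have hdv : d v = 0 := by simp [hd, orientedSimplex_apply_self 𝔽 hinj]
    have hdc : {w | d w ≠ 0} ⊆ {w | c w ≠ 0} := fun w hw hcw => by
      have hvw : orientedSimplex 𝔽 v w ≠ 0 := fun h => hw (by simp [hd, hcw, h])
      obtain ⟨σ, rfl⟩ := exists_perm_of_orientedSimplex_apply_ne_zero 𝔽 hvw
      exact hw ((hdK.2 σ v).trans (by rw [hdv, mul_zero]))
    have hlt : d.support.card < k := by
      refine hk ▸ Finset.card_lt_card
        ((Finset.ssubset_iff_of_subset fun w hw => ?_).2 ⟨v, ?_, ?_⟩)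
      · exact Finsupp.mem_support_iff.2 (hdc (Finsupp.mem_support_iff.1 hw))
      · exact Finsupp.mem_support_iff.2 hv
      · exact Finsupp.notMem_support_iff.2 hdv
    have hspan : d ∈ Submodule.span 𝔽 (orientedSimplex 𝔽 '' {w | d w ≠ 0}) := ih _ hlt hdK rfl
    have hmem := add_mem (Submodule.span_mono (Set.image_mono hdc) hspan)
      (Submodule.smul_mem _ (c v) (Submodule.subset_span (Set.mem_image_of_mem _ hv)))
    rwa [hd, sub_add_cancel] at hmem

theorem map_eq_zero_of_map_orientedSimplex_eq_zero {N : Type*} [AddCommGroup N] [Module 𝔽 N]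
    {K : PreAbstractSimplicialComplex V} {m : ℕ} (φ : ((Fin (m + 1) → V) →₀ 𝔽) →ₗ[𝔽] N)
    {c : (Fin (m + 1) → V) →₀ 𝔽} (hc : c ∈ simplicialChains 𝔽 K m)
    (h : ∀ v, c v ≠ 0 → φ (orientedSimplex 𝔽 v) = 0) : φ c = 0 :=
  (Submodule.span_le (p := LinearMap.ker φ)).2 (Set.image_subset_iff.2 h)
    (mem_span_orientedSimplex hc)

variable (𝔽 V) in
/-- The augmentation of `0`-chains, which sends every vertex to `1`. -/
noncomputable def augmentation : ((Fin 1 → V) →₀ 𝔽) →ₗ[𝔽] 𝔽 :=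
  Finsupp.linearCombination 𝔽 fun _ => 1

theorem augmentation_single (v : Fin 1 → V) (x : 𝔽) :
    augmentation 𝔽 V (Finsupp.single v x) = x := by
  simp [augmentation]

theorem augmentation_eq_zero_of_mem_boundaries {K : PreAbstractSimplicialComplex V}
    {c : (Fin 1 → V) →₀ 𝔽} (hc : c ∈ simplicialBoundaries 𝔽 K 0) : augmentation 𝔽 V c = 0 := by
  obtain ⟨d, hd, rfl⟩ := hc
  refine map_eq_zero_of_map_orientedSimplex_eq_zero
    (augmentation 𝔽 V ∘ₗ simplicialBoundary 𝔽 V 1) hd fun v _ => ?_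
  rw [List.ofFn_inj.1 (show List.ofFn v = List.ofFn ![v 0, v 1] by simp), LinearMap.comp_apply,
    simplicialBoundary_pair, map_sub, augmentation_single, augmentation_single, sub_self]

theorem simplicialCycles_zero (K : PreAbstractSimplicialComplex V) :
    simplicialCycles 𝔽 K 0 = simplicialChains 𝔽 K 0 :=
  if_pos rfl

theorem mem_chains_zero_iff {K : PreAbstractSimplicialComplex V} {c : (Fin 1 → V) →₀ 𝔽} :
    c ∈ simplicialChains 𝔽 K 0 ↔ ∀ v, c v ≠ 0 → {v 0} ∈ K.faces := by
  have hrange : ∀ (v : Fin 1 → V) (s : Finset V), (s : Set V) = Set.range v ↔ s = {v 0} :=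
    fun v s => by rw [Set.range_unique, ← Finset.coe_singleton, Finset.coe_inj]; rfl
  refine ⟨fun hc v hv => ?_, fun h => ⟨fun v hv => ?_, fun σ v => ?_⟩⟩
  · obtain ⟨-, s, hs, hsv⟩ := hc.1 v hv
    rwa [← (hrange v s).1 hsv]
  · exact ⟨Function.injective_of_subsingleton (α := Fin 1) v, _, h v hv, (hrange v _).2 rfl⟩
  · rw [Subsingleton.elim (α := Equiv.Perm (Fin 1)) σ 1]
    simp

end Chains

/-! ### The model module -/

section Limit

variable {𝔽 : Type u} [Field 𝔽] {J : Type} [Preorder J] (F : J ⥤ ModuleCat.{u} 𝔽)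

theorem limitColimitRank_of_isTop {t : J} (ht : IsTop t) :
    limitColimitRank F t = Module.finrank 𝔽 (LinearMap.range (limit.π F t).hom) := by
  have hT : IsTerminal t := IsTerminal.ofUniqueHom (fun j => homOfLE (ht j))
    (fun _ _ => Subsingleton.elim _ _)
  have := isIso_ι_of_isTerminal hT F
  have h := finrank_range_iso_comp_iso (Iso.refl _) (limit.π F t) (asIso (colimit.ι F t))
  rwa [Iso.refl_hom, Category.id_comp] at h

theorem map_limit_π_apply (x : (limit F : ModuleCat.{u} 𝔽)) {i j : J} (h : i ≤ j) :
    (F.map (homOfLE h)).hom ((limit.π F i).hom x) = (limit.π F j).hom x := by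
  rw [← limit.w F (homOfLE h)]
  rfl

theorem mem_range_limit_π {x : ∀ j, F.obj j}
    (hx : ∀ i j (h : i ≤ j), (F.map (homOfLE h)).hom (x i) = x j) (j : J) :
    x j ∈ LinearMap.range (limit.π F j).hom := by
  let s : Cone F :=
    { pt := ModuleCat.of 𝔽 𝔽
      π :=
        { app := fun j => ModuleCat.ofHom (LinearMap.toSpanSingleton 𝔽 (F.obj j) (x j))
          naturality := fun i j f => by
            ext
            change (1 : 𝔽) • x j = (F.map f).hom ((1 : 𝔽) • x i)
            rw [one_smul, one_smul, ← hx i j f.le]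
            rfl } }
  refine ⟨(limit.lift F s).hom (1 : 𝔽), ?_⟩
  have hlift : (limit.lift F s ≫ limit.π F j).hom (1 : 𝔽) = (s.π.app j).hom (1 : 𝔽) := by
    rw [limit.lift_π]
  exact hlift.trans (one_smul 𝔽 (x j))

end Limit

section Model

variable {𝔽 : Type u} [Field 𝔽] {n : ℕ}

theorem Subquotient.mk_eq_mk {W : Type u} [AddCommGroup W] [Module 𝔽 W] {Z B : Submodule 𝔽 W}
    (x y : Z) : Subquotient.mk Z B x = Subquotient.mk Z B y ↔ (x : W) - y ∈ B := by
  rw [← sub_eq_zero, ← map_sub, Subquotient.mk_eq_zero]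
  rfl

theorem singleton_mem_modelFiltration (hn : 0 < n) {p : Fin (n + 1) × Fin (n + 1)}
    {v : Fin (n + 1)} : {v} ∈ (modelFiltration n p).faces ↔
      n ≤ (p.1 : ℕ) + p.2 ∧ ((p.1 : ℕ) + p.2 = n → p.1 ≠ v) := by
  change (_ ∧ _ ∧ _) ↔ _
  simp only [Finset.singleton_nonempty, Finset.card_singleton, Finset.mem_singleton, true_and]
  exact and_congr_right fun _ => ⟨Or.rec id fun ⟨_, _, _⟩ _ => by omega, Or.inl⟩

theorem modelFiltration_boundaries_eq_bot {p : Fin (n + 1) × Fin (n + 1)}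
    (hp : p ≠ ⊤) : simplicialBoundaries 𝔽 (modelFiltration n p) 0 = ⊥ := by
  rw [eq_bot_iff]
  rintro _ ⟨c, hc, rfl⟩
  have hzero : c = 0 := by
    ext v
    by_contra h
    obtain ⟨hinj, s, ⟨-, -, hs⟩, hsv⟩ := hc.1 v h
    have hcard : s.card = 2 := by
      rw [← Set.ncard_coe_finset, hsv, ← Set.image_univ, Set.ncard_image_of_injective _ hinj,
        Set.ncard_univ, Nat.card_fin]
    refine hp (Prod.ext (Fin.ext ?_) (Fin.ext ?_)) <;>
      simp only [Prod.fst_top, Prod.snd_top, Fin.val_top] <;> omega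
  rw [hzero, map_zero]
  exact zero_mem _

theorem single_sub_single_mem_modelFiltration_boundaries (u v : Fin (n + 1)) :
    Finsupp.single ![v] (1 : 𝔽) - Finsupp.single ![u] 1 ∈
      simplicialBoundaries 𝔽 (modelFiltration n ⊤) 0 := by
  classical
  by_cases huv : u = v
  · rw [huv, sub_self]
    exact zero_mem _
  refine ⟨orientedSimplex 𝔽 ![u, v], orientedSimplex_mem_chains 𝔽 ?_ (s := {u, v}) ?_ ?_,
    simplicialBoundary_pair 𝔽 u v⟩
  · exact List.nodup_ofFn.1 (by simpa using huv)
  · exact ⟨by simp, by simp, Or.inr ⟨by simp, by simp, Finset.card_le_two⟩⟩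
  · simp [Set.pair_comm]

theorem mem_modelFiltration_boundaries {c : (Fin 1 → Fin (n + 1)) →₀ 𝔽}
    (hc : augmentation 𝔽 _ c = 0) : c ∈ simplicialBoundaries 𝔽 (modelFiltration n ⊤) 0 := by
  have hsum : c = c.sum fun v x => x • (Finsupp.single v 1 - Finsupp.single ![0] 1) := by
    have haug : ∑ v ∈ c.support, c v = 0 := by
      simpa [augmentation, Finsupp.linearCombination_apply, Finsupp.sum] using hc
    simp only [smul_sub, Finsupp.sum_sub, Finsupp.smul_single, smul_eq_mul, mul_one,
      Finsupp.sum_single]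
    rw [Finsupp.sum, ← Finsupp.single_finsetSum, haug, Finsupp.single_zero, sub_zero]
  rw [hsum]
  refine sum_mem fun v _ => Submodule.smul_mem _ _ ?_
  rw [List.ofFn_inj.1 (show List.ofFn v = List.ofFn ![v 0] by simp)]
  exact single_sub_single_mem_modelFiltration_boundaries _ _

/-- The map induced by the augmentation on the homology of the model at the top of the grid. -/
noncomputable def topAugmentation (𝔽 : Type u) [Field 𝔽] (n : ℕ) :
    SimplicialHomology 𝔽 (modelFiltration n ⊤) 0 →ₗ[𝔽] 𝔽 :=
  Submodule.liftQ _ (augmentation 𝔽 (Fin (n + 1)) ∘ₗ Submodule.subtype _)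
    fun _ hc => augmentation_eq_zero_of_mem_boundaries hc

theorem topAugmentation_injective : Function.Injective (topAugmentation 𝔽 n) := by
  refine (injective_iff_map_eq_zero _).2 fun x hx => ?_
  obtain ⟨c, rfl⟩ := Subquotient.mk_surjective _ _ x
  exact (Subquotient.mk_eq_zero c).2 (mem_modelFiltration_boundaries hx)

/-- The point `(i, n - i)` of the antidiagonal of the grid. -/
def antidiagonalPoint (i : Fin (n + 1)) : staircase (Finset.univ : Finset (Fin (n + 1))) :=
  ⟨(i, i.rev), Or.inr ⟨by simp only [Fin.val_rev]; omega, Finset.mem_univ _⟩⟩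

theorem apply_antidiagonalPoint_eq {α : Type*} (hn : 2 ≤ n)
    {f : staircase (Finset.univ : Finset (Fin (n + 1))) → α}
    (hf : ∀ p q, p ≤ q → q.1 ≠ ⊤ → f p = f q) (i : Fin (n + 1)) :
    f (antidiagonalPoint i) = f (antidiagonalPoint 0) := by
  induction i using Fin.induction with
  | zero => rfl
  | succ i ih =>
    let q : staircase (Finset.univ : Finset (Fin (n + 1))) :=
      ⟨(i.succ, i.castSucc.rev), Or.inl (by
        simp only [Fin.val_succ, Fin.val_rev, Fin.val_castSucc]; omega)⟩
    have hq : q.1 ≠ ⊤ := fun h => by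
      have h1 : (i : ℕ) + 1 = n := congrArg (fun p => (p.1 : ℕ)) h
      have h2 : (i.castSucc.rev : ℕ) = n := congrArg (fun p => (p.2 : ℕ)) h
      rw [Fin.val_rev, Fin.val_castSucc] at h2
      omega
    have hi : i.castSucc ≤ i.succ := i.castSucc_lt_succ.le
    have hsucc : antidiagonalPoint i.succ ≤ q := ⟨le_rfl, Fin.rev_le_rev.2 hi⟩
    have hcastSucc : antidiagonalPoint i.castSucc ≤ q := ⟨hi, le_rfl⟩
    rw [← ih, hf _ q hsucc hq, ← hf _ q hcastSucc hq]

theorem modelModule_section_eq_zero (hn : 2 ≤ n)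
    {x : ∀ p : staircase (Finset.univ : Finset (Fin (n + 1))),
      SimplicialHomology 𝔽 (modelFiltration n p) 0}
    (hx : ∀ (p q : staircase (Finset.univ : Finset (Fin (n + 1)))) (h : p ≤ q),
      simplicialHomologyMap 𝔽 ((modelFiltration n).monotone h) 0 (x p) = x q)
    {t : staircase (Finset.univ : Finset (Fin (n + 1)))} (ht : IsTop t) : x t = 0 := by
  choose c hc using fun p => Subquotient.mk_surjective _ _ (x p)
  -- Below the top level there are no edges, so cycles agree as soon as their classes do.
  have hconst : ∀ p q, p ≤ q → q.1 ≠ ⊤ → (c p).1 = (c q).1 := by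
    intro p q hpq hq
    have hclass := hx p q hpq
    rw [← hc, ← hc] at hclass
    have hdiff : (c p).1 - (c q).1 ∈ simplicialBoundaries 𝔽 (modelFiltration n q) 0 :=
      (Subquotient.mk_eq_mk _ _).1 hclass
    rwa [modelFiltration_boundaries_eq_bot hq, Submodule.mem_bot, sub_eq_zero] at hdiff
  have hantidiagonal := apply_antidiagonalPoint_eq hn hconst
  have hzero : c (antidiagonalPoint 0) = 0 := by
    refine Subtype.ext (Finsupp.ext fun v => by_contra fun h => ?_)
    have hmem := mem_chains_zero_iff.1 <|
      (simplicialCycles_zero _).le (c (antidiagonalPoint (v 0))).2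
    rw [hantidiagonal] at hmem
    refine ((singleton_mem_modelFiltration (by omega)).1 (hmem v h)).2 ?_ rfl
    simp only [antidiagonalPoint, Fin.val_rev]
    omega
  rw [← hx _ t (ht (antidiagonalPoint 0)), ← hc, hzero, map_zero, map_zero]

theorem generalizedRank_modelModule_univ (hn : 2 ≤ n) :
    generalizedRank (modelModule 𝔽 n)
      (.ofUpperSet (staircase Finset.univ) (top_mem_staircase (by omega) _)) = 0 := by
  set I : PosetInterval (Fin (n + 1) × Fin (n + 1)) :=
    .ofUpperSet (staircase Finset.univ) (top_mem_staircase (by omega) _)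
  let t : I.carrier := ⟨⊤, top_mem_staircase (by omega) _⟩
  have ht : IsTop t := fun _ => le_top (α := Fin (n + 1) × Fin (n + 1))
  rw [generalizedRank_eq _ I t, limitColimitRank_of_isTop _ ht]
  have hzero : (limit.π ((modelModule 𝔽 n).restrict I.carrier) t).hom = 0 :=
    LinearMap.ext fun x => modelModule_section_eq_zero hn
      (fun _ _ h => map_limit_π_apply ((modelModule 𝔽 n).restrict I.carrier) x h) ht
  rw [hzero, LinearMap.range_zero, finrank_bot]

theorem single_mem_modelFiltration_cycles (hn : 0 < n) {S : Finset (Fin (n + 1))}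
    {k : Fin (n + 1)} (hk : k ∉ S) {p : Fin (n + 1) × Fin (n + 1)} (hp : p ∈ staircase S) :
    Finsupp.single ![k] 1 ∈ simplicialCycles 𝔽 (modelFiltration n p) 0 := by
  rw [simplicialCycles_zero, mem_chains_zero_iff]
  intro v hv
  obtain rfl : ![k] = v := by_contra fun h => hv (Finsupp.single_eq_of_ne' h)
  refine (singleton_mem_modelFiltration hn).2 ?_
  rcases hp with hp | ⟨hp, hpS⟩
  · exact ⟨hp.le, fun h => absurd h hp.ne'⟩
  · exact ⟨hp.ge, fun _ h => hk ((show p.1 = k from h) ▸ hpS)⟩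

theorem generalizedRank_modelModule_of_notMem (hn : 0 < n) {S : Finset (Fin (n + 1))}
    {k : Fin (n + 1)} (hk : k ∉ S) :
    generalizedRank (modelModule 𝔽 n) (.ofUpperSet (staircase S) (top_mem_staircase hn S)) = 1 := by
  set I : PosetInterval (Fin (n + 1) × Fin (n + 1)) :=
    .ofUpperSet (staircase S) (top_mem_staircase hn S)
  let t : I.carrier := ⟨⊤, top_mem_staircase hn S⟩
  have ht : IsTop t := fun _ => le_top (α := Fin (n + 1) × Fin (n + 1))
  rw [generalizedRank_eq _ I t, limitColimitRank_of_isTop _ ht]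
  set F := (modelModule 𝔽 n).restrict I.carrier
  let x : ∀ p, F.obj p := fun p =>
    Subquotient.mk _ _ ⟨_, single_mem_modelFiltration_cycles hn hk p.2⟩
  have hxt : topAugmentation 𝔽 n (x t) = 1 := augmentation_single _ _
  have hmem : x t ∈ LinearMap.range (limit.π F t).hom :=
    mem_range_limit_π F (fun _ _ _ => rfl) t
  have : Module.Finite 𝔽 (F.obj t) :=
    Module.Finite.of_injective (topAugmentation 𝔽 n) topAugmentation_injective
  refine le_antisymm ?_ (Submodule.one_le_finrank_iff.2 fun hbot => ?_)
  · exact (LinearMap.finrank_le_finrank_of_injective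
      (f := topAugmentation 𝔽 n ∘ₗ Submodule.subtype (LinearMap.range (limit.π F t).hom))
      (topAugmentation_injective.comp Subtype.val_injective)).trans (Module.finrank_self 𝔽).le
  · rw [hbot, Submodule.mem_bot] at hmem
    rw [hmem] at hxt
    exact zero_ne_one ((map_zero (topAugmentation 𝔽 n)).symm.trans hxt)

theorem generalizedRank_modelModule (hn : 2 ≤ n) (S : Finset (Fin (n + 1))) :
    generalizedRank (modelModule 𝔽 n) (.ofUpperSet (staircase S) (top_mem_staircase (by omega) S)) =
      if S = Finset.univ then 0 else 1 := by
  split_ifs with hS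
  · subst hS
    exact generalizedRank_modelModule_univ hn
  · obtain ⟨k, hk⟩ := not_forall.1 (mt Finset.eq_univ_iff_forall.2 hS)
    exact generalizedRank_modelModule_of_notMem (by omega) hk

theorem two_pow_sub_one_le_gpdSize {P : Type} [SemilatticeSup P] (hn : 2 ≤ n)
    {M : PersistenceModule 𝔽 P} (hM : HasFiniteGPD M) (ι : Fin (n + 1) × Fin (n + 1) →o P)
    (hι : ∀ p q, ι (p ⊔ q) = ι p ⊔ ι q) (e : M.comap ι ≅ modelModule 𝔽 n) :
    (2 ^ (n + 1) - 1 : ℕ) ≤ gpdSize M := by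
  have h := hM.isGPD.two_pow_sub_one_le_encard_support
    (fun S => .hull ι (staircase S) (top_mem_staircase (by omega) S)) (fun i => ι (i, i.rev))
    (hull_staircase_le_iff ι (by omega)) fun S => by
      rw [generalizedRank_hull M hι, generalizedRank_congr e, generalizedRank_modelModule hn]
  rwa [Fintype.card_fin] at h

end Model


/-! ### Labels of the points of the witness -/

theorem le_witnessRadius {n j : ℕ} (hn : 2 ≤ n) (hj : j ≤ n) :
    (n : ℝ) - 1 / 2 ≤ witnessRadius n j := by
  have hn' : (2 : ℝ) ≤ n := by exact_mod_cast hn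
  have hj' : (j : ℝ) ≤ n := by exact_mod_cast hj
  have : (j : ℝ) / (n : ℝ) ^ 2 ≤ 1 / 2 := by
    rw [div_le_div_iff₀ (by positivity) (by norm_num)]
    nlinarith
  rw [witnessRadius]
  linarith

theorem witnessRadius_pos {n j : ℕ} (hn : 2 ≤ n) (hj : j ≤ n) : 0 < witnessRadius n j := by
  have hn' : (2 : ℝ) ≤ n := by exact_mod_cast hn
  linarith [le_witnessRadius hn hj]

theorem witnessRadius_zero (n : ℕ) : witnessRadius n 0 = n := by
  simp [witnessRadius]

theorem witnessRadius_le_iff {n j k : ℕ} (hn : 0 < n) :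
    witnessRadius n j ≤ witnessRadius n k ↔ k ≤ j := by
  rw [witnessRadius, witnessRadius, sub_le_sub_iff_left,
    div_le_div_iff_of_pos_right (by positivity), Nat.cast_le]

theorem witnessRadius_le {n : ℕ} (hn : 0 < n) (j : ℕ) : witnessRadius n j ≤ n :=
  witnessRadius_zero n ▸ (witnessRadius_le_iff hn).2 (Nat.zero_le j)

theorem abs_sub_mul_le_witnessRadius_iff {n m : ℕ} (hn : 2 ≤ n) (hm : m ≤ n) (k l : ℕ) :
    |(k : ℝ) - l| * n ≤ witnessRadius n (n - m) ↔
      k = l ∨ m = n ∧ (k + 1 = l ∨ l + 1 = k) := by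
  wlog hkl : k ≤ l generalizing k l
  · rw [abs_sub_comm, this l k (le_of_not_ge hkl), eq_comm, or_comm (a := l + 1 = k)]
  have hn' : (2 : ℝ) ≤ n := by exact_mod_cast hn
  have hpos := witnessRadius_pos hn (Nat.sub_le n m)
  have hle := witnessRadius_le (by omega : 0 < n) (n - m)
  have hone : (n : ℝ) ≤ witnessRadius n (n - m) ↔ m = n := by
    rw [← witnessRadius_zero n, witnessRadius_le_iff (by omega)]
    omega
  obtain ⟨d, rfl⟩ := Nat.exists_eq_add_of_le hkl
  rw [abs_sub_comm, Nat.cast_add, add_sub_cancel_left, Nat.abs_cast]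
  rcases (by omega : d = 0 ∨ d = 1 ∨ 2 ≤ d) with rfl | rfl | hd
  · simp [hpos.le]
  · simpa using hone
  · have hd' : (2 : ℝ) ≤ d := by exact_mod_cast hd
    exact iff_of_false (by nlinarith) (by omega)

/-- Labels of the points of the witness of parameter `n`: `inl (i, j)` stands for the square
`b_j A` in `Y_i`, `inr i` for the square `Z_i`, and the last component is the direction. -/
abbrev WitnessLabel (n : ℕ) : Type :=
  ({q : Fin (n + 1) × Fin (n + 1) // q.2 ≠ q.1} ⊕ Fin n) × Fin 4

namespace WitnessLabel

/-- The four elements of `A` in cyclic order, so that `a + 2` is the direction opposite to `a`. -/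
def direction : Fin 4 → ℝ × ℝ := ![(1, 0), (0, 1), (-1, 0), (0, -1)]

theorem range_direction : Set.range direction = directions := by
  ext a
  simp only [direction, directions, Set.mem_range, Fin.exists_fin_succ, Set.mem_insert_iff,
    Set.mem_singleton_iff, eq_comm (b := a)]
  simp

theorem direction_injective : Function.Injective direction := by
  intro a b h
  fin_cases a <;> fin_cases b <;> simp [direction] at h ⊢ <;> linarith

variable {n : ℕ}

/-- The height of the point, divided by `n`. -/
def level (v : WitnessLabel n) : ℕ :=
  Sum.elim (fun q : {q : Fin (n + 1) × Fin (n + 1) // q.2 ≠ q.1} => 2 * (q.1.1 : ℕ))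
    (fun i : Fin n => 2 * (i : ℕ) + 1) v.1

/-- The index `j` of the square `b_j A` of the point. -/
def index (v : WitnessLabel n) : ℕ :=
  Sum.elim (fun q : {q : Fin (n + 1) × Fin (n + 1) // q.2 ≠ q.1} => (q.1.2 : ℕ))
    (fun _ : Fin n => 0) v.1

/-- The value of `γ_n` at the point. -/
def value (v : WitnessLabel n) : ℕ :=
  Sum.elim (fun q : {q : Fin (n + 1) × Fin (n + 1) // q.2 ≠ q.1} => (q.1.2 : ℕ))
    (fun _ : Fin n => n) v.1

/-- The index `i` of the set `Y_i` or `Z_i` of the point. -/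
def plane (v : WitnessLabel n) : Fin (n + 1) := Sum.elim (fun q => q.1.1) Fin.castSucc v.1

/-- The point of the witness with a given label. -/
noncomputable def point (v : WitnessLabel n) : Fin 3 → ℝ :=
  ![witnessRadius n v.index * (direction v.2).1, witnessRadius n v.index * (direction v.2).2,
    v.level * n]

theorem index_le (v : WitnessLabel n) : v.index ≤ n := by
  rcases v with ⟨q | _, _⟩
  · exact Nat.lt_succ_iff.1 q.1.2.isLt
  · exact Nat.zero_le _

theorem value_le (v : WitnessLabel n) : v.value ≤ n := by
  rcases v with ⟨q | _, _⟩
  · exact Nat.lt_succ_iff.1 q.1.2.isLt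
  · exact le_rfl

theorem level_le (v : WitnessLabel n) : v.level ≤ 2 * n := by
  rcases v with ⟨⟨⟨i, j⟩, h⟩ | i, a⟩ <;> simp only [level, Sum.elim_inl, Sum.elim_inr] <;> omega

theorem eq_of_level_index_direction {v w : WitnessLabel n} (hl : v.level = w.level)
    (hi : v.index = w.index) (hd : v.2 = w.2) : v = w := by
  refine Prod.ext ?_ hd
  rcases v with ⟨⟨⟨i, j⟩, hv⟩ | i, a⟩ <;> rcases w with ⟨⟨⟨k, l⟩, hw⟩ | k, b⟩ <;>
    simp only [level, index, Sum.elim_inl, Sum.elim_inr] at hl hi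
  · obtain rfl : i = k := Fin.ext (by omega)
    obtain rfl : j = l := Fin.ext hi
    rfl
  · omega
  · omega
  · rw [show i = k from Fin.ext (by omega)]

theorem point_inl_mem (q : {q : Fin (n + 1) × Fin (n + 1) // q.2 ≠ q.1}) (a : Fin 4) :
    point (Sum.inl q, a) ∈ witnessSquare n q.1.2 (2 * (q.1.1 : ℕ) * n) :=
  ⟨direction a, range_direction ▸ ⟨a, rfl⟩, by simp [point, index, level]⟩

theorem point_inr_mem (i : Fin n) (a : Fin 4) : point (Sum.inr i, a) ∈ witnessZ n i :=
  ⟨direction a, range_direction ▸ ⟨a, rfl⟩, by simp [point, index, level]⟩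

theorem range_point : Set.range (point (n := n)) = witnessSet n := by
  refine Set.Subset.antisymm ?_ ?_
  · rintro _ ⟨⟨q | i, a⟩, rfl⟩
    · exact Or.inl (Set.mem_iUnion₂.2 ⟨q.1.1, Nat.lt_succ_iff.1 q.1.1.isLt,
        Set.mem_iUnion₂.2 ⟨q.1.2, ⟨Nat.lt_succ_iff.1 q.1.2.isLt, fun h => q.2 (Fin.ext h)⟩,
          point_inl_mem q a⟩⟩)
    · exact Or.inr (Set.mem_iUnion₂.2 ⟨i, i.isLt, point_inr_mem i a⟩)
  · rintro w (hw | hw)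
    · obtain ⟨i, hi, hw⟩ := Set.mem_iUnion₂.1 hw
      obtain ⟨j, ⟨hj, hji⟩, _, hb, rfl⟩ := Set.mem_iUnion₂.1 hw
      obtain ⟨a, rfl⟩ := range_direction.ge hb
      exact ⟨(Sum.inl ⟨(⟨i, Nat.lt_succ_iff.2 hi⟩, ⟨j, Nat.lt_succ_iff.2 hj⟩),
        fun h => hji (congrArg Fin.val h)⟩, a), by simp [point, index, level]⟩
    · obtain ⟨i, hi, _, hb, rfl⟩ := Set.mem_iUnion₂.1 hw
      obtain ⟨a, rfl⟩ := range_direction.ge hb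
      exact ⟨(Sum.inr ⟨i, hi⟩, a), by simp [point, index, level]⟩

theorem abs_point_zero_add_abs_point_one (hn : 2 ≤ n) (v : WitnessLabel n) :
    |v.point 0| + |v.point 1| = witnessRadius n v.index := by
  obtain ⟨s, a⟩ := v
  have hpos := witnessRadius_pos hn (index_le (s, a))
  simp only [point, Matrix.cons_val_zero, Matrix.cons_val_one, abs_mul, abs_of_pos hpos, ← mul_add]
  fin_cases a <;> simp [direction]

theorem point_injective (hn : 2 ≤ n) : Function.Injective (point (n := n)) := by
  intro v w h
  have hi : v.index = w.index := by
    have hr : witnessRadius n v.index = witnessRadius n w.index := by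
      rw [← abs_point_zero_add_abs_point_one hn, ← abs_point_zero_add_abs_point_one hn, h]
    have hn0 : 0 < n := by omega
    exact le_antisymm ((witnessRadius_le_iff hn0).1 hr.ge) ((witnessRadius_le_iff hn0).1 hr.le)
  have hl : v.level = w.level := by
    simpa [point, show n ≠ 0 by omega] using congrFun h 2
  have hd : direction v.2 = direction w.2 := by
    have hr := (witnessRadius_pos hn w.index_le).ne'
    refine Prod.ext ?_ ?_
    · simpa [point, hi, hr] using congrFun h 0
    · simpa [point, hi, hr] using congrFun h 1
  exact eq_of_level_index_direction hl hi (direction_injective hd)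

/-- The bijection between the points of the witness and their labels. -/
noncomputable def label (hn : 2 ≤ n) : witnessSet n ≃ WitnessLabel n :=
  ((Equiv.ofInjective point (point_injective hn)).trans (Equiv.setCongr range_point)).symm

theorem coe_label_symm (hn : 2 ≤ n) (v : WitnessLabel n) :
    ((label hn).symm v : Fin 3 → ℝ) = v.point := rfl

theorem witnessGamma_label_symm (hn : 2 ≤ n) (v : WitnessLabel n) :
    witnessGamma n ((label hn).symm v) = v.value := by
  rcases v with ⟨q | i, a⟩
  · exact witnessGamma_of_mem_Y (i := q.1.1) hn (Nat.lt_succ_iff.1 q.1.2.isLt) _ (point_inl_mem q a)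
  · exact witnessGamma_of_mem_Z i.isLt _ (point_inr_mem i a)

end WitnessLabel

theorem finite_witnessSet {n : ℕ} (hn : 2 ≤ n) : (witnessSet n).Finite :=
  Set.finite_coe_iff.1 (Finite.of_equiv _ (WitnessLabel.label hn).symm)

theorem ncard_witnessSet {n : ℕ} (hn : 2 ≤ n) : (witnessSet n).ncard = 4 * n * (n + 2) := by
  have hdiag : Fintype.card {q : Fin (n + 1) × Fin (n + 1) // q.2 = q.1} = n + 1 := by
    rw [Fintype.card_congr (β := Fin (n + 1))
      ⟨fun q => q.1.1, fun i => ⟨(i, i), rfl⟩, fun q => Subtype.ext (Prod.ext rfl q.2.symm),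
        fun _ => rfl⟩, Fintype.card_fin]
  have hoff : Fintype.card {q : Fin (n + 1) × Fin (n + 1) // q.2 ≠ q.1} = (n + 1) * n := by
    rw [Fintype.card_subtype_compl, hdiag, Fintype.card_prod, Fintype.card_fin, ← Nat.mul_sub_one,
      Nat.add_sub_cancel]
  rw [← Nat.card_coe_set_eq, Nat.card_congr (WitnessLabel.label hn), Nat.card_eq_fintype_card,
    Fintype.card_prod, Fintype.card_sum, hoff, Fintype.card_fin, Fintype.card_fin]
  ring

/-! ### Adjacency of the points of the witness -/

/-- `K` is the flag complex of the relation `r`, which is not assumed to be reflexive: the vertices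
of `K` are the points related to themselves. -/
def IsFlagComplex {V : Type} (K : PreAbstractSimplicialComplex V) (r : V → V → Prop) : Prop :=
  ∀ s, s ∈ K.faces ↔ s.Nonempty ∧ ∀ x ∈ s, ∀ y ∈ s, r x y

namespace WitnessLabel

variable {n : ℕ}

/-- In terms of labels, two points both lie in the sublevel set of `γ_n` at `p.1` and have distance
at most `β_{p.2}`. -/
def Adj (p : Fin (n + 1) × Fin (n + 1)) (v w : WitnessLabel n) : Prop :=
  (v.value ≤ p.1 ∧ w.value ≤ p.1) ∧
  (w.2 ≠ v.2 + 2 ∧ (v.2 = w.2 ∨ n ≤ v.index + p.2 ∧ n ≤ w.index + p.2)) ∧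
  (v.level = w.level ∨ (p.2 : ℕ) = n ∧ (v.level + 1 = w.level ∨ w.level + 1 = v.level))

theorem abs_sub_direction_le_iff {x y b : ℝ} (hx : 0 < x) (hy : 0 < y) (hxy : |x - y| ≤ b)
    (hb : b < x + y) (a a' : Fin 4) :
    |x * (direction a).1 - y * (direction a').1| ≤ b ∧
        |x * (direction a).2 - y * (direction a').2| ≤ b ↔
      a' ≠ a + 2 ∧ (a = a' ∨ x ≤ b ∧ y ≤ b) := by
  have hb0 : 0 ≤ b := (abs_nonneg _).trans hxy
  have hyx : |-x + y| ≤ b := by rwa [neg_add_eq_sub, abs_sub_comm]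
  have hopp : ¬ |x + y| ≤ b := by rwa [abs_of_pos (by positivity), not_le]
  have hopp' : ¬ |-x - y| ≤ b := by rwa [← neg_add', abs_neg]
  fin_cases a <;> fin_cases a' <;>
    simp [direction, hb0, hxy, hyx, hopp, hopp', abs_of_pos hx, abs_of_pos hy, and_comm]

theorem dist_point_le_iff (hn : 2 ≤ n) {m : ℕ} (hm : m ≤ n) (v w : WitnessLabel n) :
    dist v.point w.point ≤ witnessRadius n (n - m) ↔
      (w.2 ≠ v.2 + 2 ∧ (v.2 = w.2 ∨ n ≤ v.index + m ∧ n ≤ w.index + m)) ∧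
      (v.level = w.level ∨ m = n ∧ (v.level + 1 = w.level ∨ w.level + 1 = v.level)) := by
  have hn0 : 0 < n := by omega
  have hn' : (2 : ℝ) ≤ n := by exact_mod_cast hn
  have hv := le_witnessRadius hn v.index_le
  have hv' := witnessRadius_le hn0 v.index
  have hw := le_witnessRadius hn w.index_le
  have hw' := witnessRadius_le hn0 w.index
  have hb := le_witnessRadius hn (Nat.sub_le n m)
  have hb' := witnessRadius_le hn0 (n - m)
  rw [dist_pi_le_iff (by linarith)]
  simp only [Fin.forall_fin_succ, Real.dist_eq, point, Matrix.cons_val_zero, Matrix.cons_val_succ,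
    IsEmpty.forall_iff, and_true, ← sub_mul, abs_mul, Nat.abs_cast]
  rw [← and_assoc, abs_sub_direction_le_iff (by linarith) (by linarith)
    (by rw [abs_le]; constructor <;> linarith) (by linarith), witnessRadius_le_iff hn0,
    witnessRadius_le_iff hn0, abs_sub_mul_le_witnessRadius_iff hn hm, Nat.sub_le_iff_le_add,
    Nat.sub_le_iff_le_add]

theorem adj_label_iff (hn : 2 ≤ n) (p : Fin (n + 1) × Fin (n + 1)) (x y : witnessSet n) :
    Adj p (label hn x) (label hn y) ↔
      (witnessGamma n x ≤ (p.1 : ℕ) ∧ witnessGamma n y ≤ (p.1 : ℕ)) ∧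
        dist x y ≤ witnessRadius n (n - p.2) := by
  obtain ⟨v, rfl⟩ := (label hn).symm.surjective x
  obtain ⟨w, rfl⟩ := (label hn).symm.surjective y
  rw [Equiv.apply_symm_apply, Equiv.apply_symm_apply, witnessGamma_label_symm,
    witnessGamma_label_symm, Nat.cast_le, Nat.cast_le, Subtype.dist_eq, coe_label_symm,
    coe_label_symm, dist_point_le_iff hn (Nat.lt_succ_iff.1 p.2.isLt)]
  rfl

theorem isFlagComplex_sublevelRips (hn : 2 ≤ n) (p : Fin (n + 1) × Fin (n + 1)) :
    IsFlagComplex (sublevelRips (witnessGamma n) (gridEmbedding n 1 p))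
      fun x y => Adj p (label hn x) (label hn y) := by
  intro s
  have hr : ((1 * (witnessRadius n (n - p.2)).toNNReal : ℝ≥0) : ℝ) =
      witnessRadius n (n - p.2) := by
    rw [one_mul, Real.coe_toNNReal _ (witnessRadius_pos hn (Nat.sub_le n p.2)).le]
  change (_ ∧ (∀ x ∈ s, witnessGamma n x ≤ (p.1 : ℕ)) ∧ ∀ x ∈ s, ∀ y ∈ s,
    dist x y ≤ (1 * (witnessRadius n (n - p.2)).toNNReal : ℝ≥0)) ↔ _
  simp only [hr, adj_label_iff]
  exact and_congr_right fun _ => ⟨fun h x hx y hy => ⟨⟨h.1 x hx, h.1 y hy⟩, h.2 x hx y hy⟩,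
    fun h => ⟨fun x hx => (h x hx x hx).1.1, fun x hx y hy => (h x hx y hy).2⟩⟩

end WitnessLabel

theorem exists_forall_dist_le_of_forall_dist_le_two_mul {α : Type*} {s : Finset α}
    (hs : s.Nonempty) {f : α → ℝ} {r : ℝ} (h : ∀ a ∈ s, ∀ b ∈ s, dist (f a) (f b) ≤ 2 * r) :
    ∃ y, ∀ a ∈ s, dist y (f a) ≤ r := by
  obtain ⟨a, ha, hinf⟩ := s.exists_mem_eq_inf' hs f
  obtain ⟨b, hb, hsup⟩ := s.exists_mem_eq_sup' hs f
  have hba := (abs_le.1 (h b hb a ha)).2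
  refine ⟨(f a + f b) / 2, fun x hx => ?_⟩
  have hax : f a ≤ f x := hinf ▸ s.inf'_le f hx
  have hxb : f x ≤ f b := hsup ▸ s.le_sup' f hx
  rw [Real.dist_eq, abs_le]
  constructor <;> linarith

/-- Balls of the supremum metric are products of intervals, so they have the Helly property. -/
theorem cechComplex_eq_ripsComplex {ι : Type} [Fintype ι] {X : Set (ι → ℝ)} (S : Set X)
    (r : ℝ≥0) : cechComplex S r = ripsComplex S (2 * r) := by
  ext s
  refine and_congr_right fun hs => and_congr_right fun _ => ?_
  simp only [Set.Nonempty, Set.mem_iInter, Metric.mem_closedBall, NNReal.coe_mul,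
    NNReal.coe_ofNat]
  constructor
  · rintro ⟨y, hy⟩ a ha b hb
    rw [Subtype.dist_eq, two_mul]
    exact (dist_triangle_left _ _ y).trans (add_le_add (hy a ha) (hy b hb))
  · intro h
    choose y hy using fun i => exists_forall_dist_le_of_forall_dist_le_two_mul hs
      (f := fun x : X => (x : ι → ℝ) i) fun a ha b hb =>
        (dist_le_pi_dist (a : ι → ℝ) b i).trans (h a ha b hb)
    exact ⟨y, fun x hx => (dist_pi_le_iff r.coe_nonneg).2 fun i => hy i x hx⟩

/-! ### Potentials of cocycles -/

/-- The alternating `1`-cocycles of the flag complex of the relation `r`, as functions on pairs of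
vertices, with arbitrary alternating values on the pairs that are not edges. -/
structure IsOneCocycle {V 𝔽 : Type*} [AddCommGroup 𝔽] (r : V → V → Prop) (g : V → V → 𝔽) :
    Prop where
  self_eq_zero : ∀ v, g v v = 0
  eq_neg_swap : ∀ v w, g v w = -g w v
  add_eq : ∀ u v w, r u v → r v w → r u w → g u v + g v w = g u w

theorem IsOneCocycle.eq_add_sub_of_square {V 𝔽 : Type*} [AddCommGroup 𝔽] {r : V → V → Prop}
    {g : V → V → 𝔽} (hg : IsOneCocycle r g) {v v' w w' : V} (hv : r v' v) (hw : r w' w)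
    (hvw : r v w) (hdiag : r v' w) (hvw' : r v' w') :
    g v w = g v' w' + g w' w - g v' v := by
  rw [hg.add_eq v' w' w hvw' hw hdiag, eq_sub_iff_add_eq', hg.add_eq v' v w hv hvw hdiag]

/-- The indicator of the directed edge from `0` to `1` of the `4`-cycle of directions. Windings
around the axis are counted by the signed number of passages through this edge. -/
def crossing (a b : Fin 4) : ℤ := if a = 0 ∧ b = 1 then 1 else 0

theorem crossing_triangle {a b c : Fin 4} (hab : b ≠ a + 2) (hbc : c ≠ b + 2) (hca : a ≠ c + 2) :
    crossing a b - crossing b a + (crossing b c - crossing c b) +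
      (crossing c a - crossing a c) = 0 := by
  revert a b c
  decide

theorem crossing_self (a : Fin 4) : crossing a a = 0 := by
  revert a
  decide

section Potential

variable {𝔽 : Type u} [Field 𝔽]

theorem exists_potential_four_cycle (G : Fin 4 → Fin 4 → 𝔽) (hself : ∀ a, G a a = 0)
    (hswap : ∀ a b, G a b = -G b a) :
    ∃ (F : Fin 4 → 𝔽) (c : 𝔽), ∀ a b, b ≠ a + 2 →
      G a b = F b - F a + (crossing a b * c - crossing b a * c) := by
  refine ⟨![G 1 2 + G 2 3 + G 3 0, 0, G 1 2, G 1 2 + G 2 3], G 0 1 + G 1 2 + G 2 3 + G 3 0,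
    fun a b hab => ?_⟩
  fin_cases a <;> fin_cases b <;>
    simp [hself, crossing, hswap 1 0, hswap 2 1, hswap 3 2, hswap 0 3] at hab ⊢
  all_goals ring

namespace WitnessLabel

variable {n : ℕ} {p : Fin (n + 1) × Fin (n + 1)} {v v' w w' : WitnessLabel n}

theorem ne_add_two (a : Fin 4) : a ≠ a + 2 := by
  revert a
  decide

theorem adj_self (h : v.value ≤ p.1) : Adj p v v :=
  ⟨⟨h, h⟩, ⟨ne_add_two v.2, Or.inl rfl⟩, Or.inl rfl⟩

theorem Adj.refl_left (h : Adj p v w) : Adj p v v :=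
  adj_self h.1.1

theorem Adj.symm (h : Adj p v w) : Adj p w v := by
  obtain ⟨⟨hv, hw⟩, ⟨hopp, hdir⟩, hlev⟩ := h
  refine ⟨⟨hw, hv⟩, ⟨fun e => hopp ?_, hdir.imp Eq.symm And.symm⟩,
    hlev.imp Eq.symm (And.imp_right Or.symm)⟩
  rw [e, add_assoc, show (2 + 2 : Fin 4) = 0 from rfl, add_zero]

theorem Adj.level_eq_of_ne_top (hp : p ≠ ⊤) (h : Adj p v w) : v.level = w.level := by
  obtain ⟨⟨hv, hw⟩, -, hlev | ⟨hp2, hlev⟩⟩ := h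
  · exact hlev
  · have hp1 : (p.1 : ℕ) ≠ n := fun e => hp (Prod.ext (Fin.ext e) (Fin.ext hp2))
    rcases v with ⟨⟨⟨i, j⟩, hij⟩ | i, a⟩ <;> rcases w with ⟨⟨⟨k, l⟩, hkl⟩ | k, b⟩ <;>
      simp only [level, value, Sum.elim_inl, Sum.elim_inr] at * <;> omega

theorem plane_eq_of_level_eq (h : v.level = w.level) : v.plane = w.plane := by
  rcases v with ⟨⟨⟨i, j⟩, hv⟩ | i, a⟩ <;> rcases w with ⟨⟨⟨k, l⟩, hw⟩ | k, b⟩ <;>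
    simp only [level, plane, Sum.elim_inl, Sum.elim_inr] at h ⊢
  · exact Fin.ext (by omega)
  · omega
  · omega
  · rw [show i = k from Fin.ext (by omega)]

theorem Adj.level_eq_two_mul_plane (hp : p ≠ ⊤) (h : Adj p v w) (hvw : v.2 ≠ w.2) :
    v.level = 2 * v.plane := by
  obtain ⟨⟨hv, -⟩, ⟨-, hdir | ⟨hdir, -⟩⟩, -⟩ := h
  · exact absurd hdir hvw
  · rcases v with ⟨⟨⟨i, j⟩, hij⟩ | i, a⟩
    · rfl
    · simp only [value, index, Sum.elim_inr, zero_add] at hv hdir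
      exact absurd (Prod.ext (Fin.ext (by simp; omega)) (Fin.ext (by simp; omega))) hp

theorem exists_level_eq (hn : 0 < n) {l : ℕ} (hl : l ≤ 2 * n) (a : Fin 4) :
    ∃ v : WitnessLabel n, v.level = l ∧ v.2 = a := by
  have : Nontrivial (Fin (n + 1)) := Fin.nontrivial_iff_two_le.2 (by omega)
  rcases Nat.even_or_odd' l with ⟨i, rfl | rfl⟩
  · obtain ⟨j, hj⟩ := exists_ne (⟨i, by omega⟩ : Fin (n + 1))
    exact ⟨(Sum.inl ⟨(⟨i, by omega⟩, j), hj⟩, a), rfl, rfl⟩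
  · exact ⟨(Sum.inr ⟨i, by omega⟩, a), rfl, rfl⟩

/-- The label `v'` is present at `p` and has the level and direction of `v`, but index at least
that of `v`. All neighbours of `v` are then neighbours of `v'`. -/
def Dominates (p : Fin (n + 1) × Fin (n + 1)) (v' v : WitnessLabel n) : Prop :=
  v'.value ≤ p.1 ∧ v'.level = v.level ∧ v'.2 = v.2 ∧ v.index ≤ v'.index

theorem dominates_self (h : v.value ≤ p.1) : Dominates p v v :=
  ⟨h, rfl, rfl, le_rfl⟩

theorem Adj.of_dominates (h : Adj p v w) (hv : Dominates p v' v) (hw : Dominates p w' w) :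
    Adj p v' w' := by
  obtain ⟨-, ⟨hopp, hdir⟩, hlev⟩ := h
  obtain ⟨hv1, hv2, hv3, hv4⟩ := hv
  obtain ⟨hw1, hw2, hw3, hw4⟩ := hw
  rw [← hv3, ← hw3] at hopp hdir
  rw [← hv2, ← hw2] at hlev
  exact ⟨⟨hv1, hw1⟩, ⟨hopp, hdir.imp_right fun h => by omega⟩, hlev⟩

theorem exists_dominates (hn : 0 < n) (p : Fin (n + 1) × Fin (n + 1)) :
    ∃ B : ℕ → Fin 4 → WitnessLabel n,
      ∀ v : WitnessLabel n, v.value ≤ p.1 → Dominates p (B v.level v.2) v := by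
  have hcolumn (l : ℕ) (a : Fin 4) : ∃ b : WitnessLabel n, ∀ v : WitnessLabel n,
      v.value ≤ p.1 → v.level = l → v.2 = a → Dominates p b v := by
    let s : Set (WitnessLabel n) := {v | v.value ≤ p.1 ∧ v.level = l ∧ v.2 = a}
    rcases s.eq_empty_or_nonempty with hs | hs
    · obtain ⟨b, -⟩ := exists_level_eq hn (Nat.zero_le _) 0
      exact ⟨b, fun v h1 h2 h3 =>
        absurd ⟨h1, h2, h3⟩ (Set.eq_empty_iff_forall_notMem.1 hs v)⟩
    · obtain ⟨b, ⟨hb1, hb2, hb3⟩, hb⟩ := Set.exists_max_image s index (Set.toFinite s) hs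
      exact ⟨b, fun v h1 h2 h3 => ⟨hb1, hb2.trans h2.symm, hb3.trans h3.symm, hb v ⟨h1, h2, h3⟩⟩⟩
  choose B hB using hcolumn
  exact ⟨B, fun v hv => hB _ _ v hv rfl rfl⟩

theorem exists_potential_of_ne_top (hn : 0 < n) (hp : p ≠ ⊤)
    {g : WitnessLabel n → WitnessLabel n → 𝔽} (hg : IsOneCocycle (Adj p) g) :
    ∃ (f : WitnessLabel n → 𝔽) (c : Fin (n + 1) → 𝔽), ∀ v w, Adj p v w →
      g v w = f w - f v + (crossing v.2 w.2 * c v.plane - crossing w.2 v.2 * c w.plane) := by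
  obtain ⟨B, hB⟩ := exists_dominates hn p
  choose F c hF using fun l : ℕ => exists_potential_four_cycle (fun a b => g (B l a) (B l b))
    (fun a => hg.self_eq_zero _) (fun a b => hg.eq_neg_swap _ _)
  refine ⟨fun v => g (B v.level v.2) v + F v.level v.2, fun i => c (2 * i), fun v w h => ?_⟩
  have hv := hB v h.1.1
  have hw := hB w h.1.2
  have hv' := dominates_self h.1.1
  have hw' := dominates_self h.1.2
  have hsquare := hg.eq_add_sub_of_square (h.refl_left.of_dominates hv hv')
    (h.symm.refl_left.of_dominates hw hw') h (h.of_dominates hv hw') (h.of_dominates hv hw)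
  have hlevel := h.level_eq_of_ne_top hp
  have hcycle := hF v.level v.2 w.2 h.2.1.1
  have hc : crossing v.2 w.2 * c v.level - crossing w.2 v.2 * c v.level =
      (crossing v.2 w.2 * c (2 * v.plane) - crossing w.2 v.2 * c (2 * w.plane) : 𝔽) := by
    by_cases hd : v.2 = w.2
    · simp [hd, crossing_self]
    · rw [← plane_eq_of_level_eq hlevel, ← h.level_eq_two_mul_plane hp hd]
  rw [hc] at hcycle
  beta_reduce
  rw [← hlevel] at hsquare ⊢
  linear_combination hsquare + hcycle

theorem adj_top_iff : Adj ⊤ v w ↔ w.2 ≠ v.2 + 2 ∧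
    (v.level = w.level ∨ v.level + 1 = w.level ∨ w.level + 1 = v.level) := by
  simp [Adj, value_le]

/-- `B` selects one point in every level and direction; pushing the levels down one at a time
shows that the pullbacks of `g` along the truncations of the level are cohomologous. -/
theorem exists_potential_truncation {g : WitnessLabel n → WitnessLabel n → 𝔽}
    (hg : IsOneCocycle (Adj ⊤) g) {B : ℕ → Fin 4 → WitnessLabel n}
    (hB : ∀ l ≤ 2 * n, ∀ a, (B l a).level = l ∧ (B l a).2 = a) (L : ℕ) :
    ∃ f : WitnessLabel n → 𝔽, ∀ v w, Adj ⊤ v w →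
      g (B (min v.level L) v.2) (B (min w.level L) w.2) =
        f w - f v + g (B 0 v.2) (B 0 w.2) := by
  induction L with
  | zero => exact ⟨0, fun v w _ => by simp⟩
  | succ L ih =>
    obtain ⟨f, hf⟩ := ih
    refine ⟨fun v => f v + g (B (min v.level L) v.2) (B (min v.level (L + 1)) v.2),
      fun v w h => ?_⟩
    have hmin (k : ℕ) (v : WitnessLabel n) := hB (min v.level k)
      ((min_le_left _ _).trans v.level_le) v.2
    have hadj {k l : ℕ} (hkl : k ≤ l) (hlk : l ≤ k + 1) {v w : WitnessLabel n} (h : Adj ⊤ v w) :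
        Adj ⊤ (B (min v.level k) v.2) (B (min w.level l) w.2) := by
      rw [adj_top_iff] at h ⊢
      rw [(hmin k v).1, (hmin k v).2, (hmin l w).1, (hmin l w).2]
      exact ⟨h.1, by omega⟩
    have hsquare := hg.eq_add_sub_of_square
      (hadj L.le_succ le_rfl h.refl_left) (hadj L.le_succ le_rfl h.symm.refl_left)
      (hadj le_rfl (L + 1).le_succ h) (hadj L.le_succ le_rfl h) (hadj le_rfl L.le_succ h)
    linear_combination hf v w h + hsquare

theorem exists_potential_top (hn : 0 < n) {g : WitnessLabel n → WitnessLabel n → 𝔽}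
    (hg : IsOneCocycle (Adj ⊤) g) :
    ∃ (f : WitnessLabel n → 𝔽) (c : 𝔽), ∀ v w, Adj ⊤ v w →
      g v w = f w - f v + (crossing v.2 w.2 * c - crossing w.2 v.2 * c) := by
  have : Nonempty (WitnessLabel n) := (exists_level_eq hn (Nat.zero_le _) 0).nonempty
  choose! B hB using fun (l : ℕ) (hl : l ≤ 2 * n) (a : Fin 4) => exists_level_eq hn hl a
  obtain ⟨f, hf⟩ := exists_potential_truncation hg hB (2 * n)
  obtain ⟨F, c, hF⟩ := exists_potential_four_cycle (fun a b => g (B 0 a) (B 0 b))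
    (fun a => hg.self_eq_zero _) (fun a b => hg.eq_neg_swap _ _)
  refine ⟨fun v => f v + F v.2 + g (B v.level v.2) v, c, fun v w h => ?_⟩
  have htrunc := hf v w h
  rw [min_eq_left v.level_le, min_eq_left w.level_le] at htrunc
  have hcycle := hF v.2 w.2 h.2.1.1
  have hBv := hB _ v.level_le v.2
  have hBw := hB _ w.level_le w.2
  have hsquare := hg.eq_add_sub_of_square (v' := B v.level v.2) (w' := B w.level w.2)
    (by rw [adj_top_iff, hBv.1, hBv.2]; exact adj_top_iff.1 h.refl_left)
    (by rw [adj_top_iff, hBw.1, hBw.2]; exact adj_top_iff.1 h.symm.refl_left) h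
    (by rw [adj_top_iff, hBv.1, hBv.2]; exact adj_top_iff.1 h)
    (by rw [adj_top_iff, hBv.1, hBv.2, hBw.1, hBw.2]; exact adj_top_iff.1 h)
  linear_combination htrunc + hcycle + hsquare

theorem exists_potential (hn : 0 < n) {g : WitnessLabel n → WitnessLabel n → 𝔽}
    (hg : IsOneCocycle (Adj p) g) :
    ∃ (f : WitnessLabel n → 𝔽) (c : Fin (n + 1) → 𝔽), (p = ⊤ → ∀ i j, c i = c j) ∧
      ∀ v w, Adj p v w →
        g v w = f w - f v + (crossing v.2 w.2 * c v.plane - crossing w.2 v.2 * c w.plane) := by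
  by_cases hp : p = ⊤
  · subst hp
    obtain ⟨f, c, h⟩ := exists_potential_top hn hg
    exact ⟨f, fun _ => c, fun _ _ _ => rfl, h⟩
  · obtain ⟨f, c, h⟩ := exists_potential_of_ne_top hn hp hg
    exact ⟨f, c, fun e => absurd e hp, h⟩

end WitnessLabel

end Potential

/-! ### Homology of the witnesses -/

section SubquotientMap

variable {𝔽 : Type u} [Field 𝔽] {W W' : Type u} [AddCommGroup W] [Module 𝔽 W] [AddCommGroup W']
  [Module 𝔽 W']

/-- The map of subquotients induced by a linear map between the ambient spaces. -/
def Subquotient.mapOfLinear {Z B : Submodule 𝔽 W} {Z' B' : Submodule 𝔽 W'} (L : W →ₗ[𝔽] W')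
    (hZ : ∀ c ∈ Z, L c ∈ Z') (hB : ∀ c ∈ B, L c ∈ B') :
    Subquotient Z B →ₗ[𝔽] Subquotient Z' B' :=
  Submodule.mapQ (B.submoduleOf Z) (B'.submoduleOf Z') (L.restrict hZ) fun _ hc => hB _ hc

theorem Subquotient.mapOfLinear_mk {Z B : Submodule 𝔽 W} {Z' B' : Submodule 𝔽 W'} (L : W →ₗ[𝔽] W')
    (hZ : ∀ c ∈ Z, L c ∈ Z') (hB : ∀ c ∈ B, L c ∈ B') (c : Z) :
    Subquotient.mapOfLinear L hZ hB (Subquotient.mk Z B c) =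
      Subquotient.mk Z' B' ⟨L c, hZ c c.2⟩ := rfl

theorem Subquotient.mapOfLinear_bijective {Z B : Submodule 𝔽 W} {Z' B' : Submodule 𝔽 W'}
    (L : W →ₗ[𝔽] W') (hZ : ∀ c ∈ Z, L c ∈ Z') (hB : ∀ c ∈ B, L c ∈ B')
    (hinj : ∀ c ∈ Z, L c ∈ B' → c ∈ B) (hsurj : ∀ d ∈ Z', ∃ c ∈ Z, L c = d) :
    Function.Bijective (Subquotient.mapOfLinear L hZ hB) := by
  constructor
  · refine (injective_iff_map_eq_zero _).2 fun x hx => ?_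
    obtain ⟨c, rfl⟩ := Subquotient.mk_surjective _ _ x
    rw [Subquotient.mapOfLinear_mk, Subquotient.mk_eq_zero] at hx
    exact (Subquotient.mk_eq_zero c).2 (hinj c c.2 hx)
  · intro y
    obtain ⟨⟨d, hd⟩, rfl⟩ := Subquotient.mk_surjective _ _ y
    obtain ⟨c, hc, rfl⟩ := hsurj d hd
    exact ⟨Subquotient.mk _ _ ⟨c, hc⟩, rfl⟩

end SubquotientMap

/-- An isomorphism of persistence modules from pointwise isomorphisms that commute with the
structure maps. -/
def PersistenceModule.isoOfComponents {𝔽 : Type u} [Field 𝔽] {P : Type} [PartialOrder P]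
    {M N : PersistenceModule 𝔽 P} (e : ∀ p, M.obj p ≅ N.obj p)
    (h : ∀ p q (h : p ≤ q), M.map (homOfLE h) ≫ (e q).hom = (e p).hom ≫ N.map (homOfLE h)) :
    M ≅ N :=
  NatIso.ofComponents e fun f => h _ _ f.le

section FlagComplex

variable {𝔽 : Type u} [Field 𝔽] {V : Type} {K : PreAbstractSimplicialComplex V} {r : V → V → Prop}

theorem IsFlagComplex.rel_of_mem_chains (hK : IsFlagComplex K r) {m : ℕ}
    {c : (Fin (m + 1) → V) →₀ 𝔽} (hc : c ∈ simplicialChains 𝔽 K m) {v : Fin (m + 1) → V}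
    (hv : c v ≠ 0) (i j : Fin (m + 1)) : r (v i) (v j) := by
  obtain ⟨-, s, hs, hsv⟩ := hc.1 v hv
  have hmem (k : Fin (m + 1)) : v k ∈ s := Finset.mem_coe.1 (hsv ▸ ⟨k, rfl⟩)
  exact ((hK s).1 hs).2 _ (hmem i) _ (hmem j)

theorem IsFlagComplex.orientedSimplex_mem_chains (hK : IsFlagComplex K r) {m : ℕ}
    {v : Fin (m + 1) → V} (hv : Function.Injective v) (h : ∀ i j, r (v i) (v j)) :
    orientedSimplex 𝔽 v ∈ simplicialChains 𝔽 K m := by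
  classical
  exact _root_.orientedSimplex_mem_chains 𝔽 hv (s := Finset.univ.image v)
    ((hK _).2 ⟨by simp, by simpa using h⟩) (by simp)

theorem IsFlagComplex.isOneCocycle (hK : IsFlagComplex K r) (hsymm : ∀ x y, r x y → r y x)
    (hrefl : ∀ x y, r x y → r x x) {φ : ((Fin 2 → V) →₀ 𝔽) →ₗ[𝔽] 𝔽}
    (hφ : simplicialBoundaries 𝔽 K 1 ≤ LinearMap.ker φ) :
    IsOneCocycle r fun x y => φ (orientedSimplex 𝔽 ![x, y]) := by
  have hself (x : V) : φ (orientedSimplex 𝔽 ![x, x]) = 0 := by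
    rw [orientedSimplex_pair, sub_self, map_zero]
  have hswap (x y : V) : φ (orientedSimplex 𝔽 ![x, y]) = -φ (orientedSimplex 𝔽 ![y, x]) := by
    rw [orientedSimplex_pair_swap, map_neg]
  refine ⟨hself, hswap, fun x y z hxy hyz hxz => ?_⟩
  rcases eq_or_ne x y with rfl | hne
  · rw [hself, zero_add]
  rcases eq_or_ne y z with rfl | hne'
  · rw [hself, add_zero]
  rcases eq_or_ne x z with rfl | hne''
  · rw [hswap y, add_neg_cancel, hself]
  rw [hswap x z, eq_neg_iff_add_eq_zero, ← map_add, ← map_add, ← simplicialBoundary_triple]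
  refine hφ ⟨_, hK.orientedSimplex_mem_chains (List.nodup_ofFn.1 (by simp [*])) fun i j => ?_, rfl⟩
  have hx := hrefl x y hxy
  have hy := hrefl y z hyz
  have hz := hrefl z y (hsymm y z hyz)
  fin_cases i <;> fin_cases j <;> first | assumption | exact hsymm _ _ (by assumption)

theorem mem_simplicialCycles_one_iff {c : (Fin 2 → V) →₀ 𝔽} :
    c ∈ simplicialCycles 𝔽 K 1 ↔ c ∈ simplicialChains 𝔽 K 1 ∧ simplicialBoundary 𝔽 V 1 c = 0 := by
  rw [simplicialCycles, if_neg one_ne_zero]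
  rfl

end FlagComplex

namespace WitnessLabel

section Winding

variable {n : ℕ} (hn : 2 ≤ n) (𝔽 : Type u) [Field 𝔽]

/-- The winding numbers of a `1`-chain of the witness around the axis, as a `0`-chain of the model:
every plane is a vertex, whose coefficient is the signed number of crossings in that plane. -/
noncomputable def winding : ((Fin 2 → witnessSet n) →₀ 𝔽) →ₗ[𝔽] ((Fin 1 → Fin (n + 1)) →₀ 𝔽) :=
  Finsupp.linearCombination 𝔽 fun v =>
    Finsupp.single ![(label hn (v 0)).plane] (crossing (label hn (v 0)).2 (label hn (v 1)).2 : 𝔽)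

theorem winding_orientedSimplex (x y : witnessSet n) :
    winding hn 𝔽 (orientedSimplex 𝔽 ![x, y]) =
      Finsupp.single ![(label hn x).plane] (crossing (label hn x).2 (label hn y).2 : 𝔽) -
        Finsupp.single ![(label hn y).plane] (crossing (label hn y).2 (label hn x).2 : 𝔽) := by
  simp [orientedSimplex_pair, winding]

variable {𝔽 hn} {p : Fin (n + 1) × Fin (n + 1)}

theorem singleton_plane_mem_modelFiltration (hn : 0 < n) {v w : WitnessLabel n} (h : Adj p v w)
    (hvw : v.2 ≠ w.2) : {v.plane} ∈ (modelFiltration n p).faces := by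
  rw [singleton_mem_modelFiltration hn]
  obtain ⟨⟨hvalue, -⟩, ⟨-, hdir | ⟨hindex, -⟩⟩, -⟩ := h
  · exact absurd hdir hvw
  · rcases v with ⟨⟨⟨i, j⟩, hij⟩ | i, a⟩
    · simp only [value, index, plane, Sum.elim_inl] at hvalue hindex ⊢
      exact ⟨by omega, fun hsum hi => hij (Fin.ext (by subst hi; dsimp only; omega))⟩
    · simp only [value, index, plane, Sum.elim_inr] at hvalue hindex ⊢
      exact ⟨by omega, fun hsum => by omega⟩

theorem winding_mem_chains {c : (Fin 2 → witnessSet n) →₀ 𝔽}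
    (hc : c ∈ simplicialChains 𝔽 (sublevelRips (witnessGamma n) (gridEmbedding n 1 p)) 1) :
    winding hn 𝔽 c ∈ simplicialChains 𝔽 (modelFiltration n p) 0 := by
  rw [winding, Finsupp.linearCombination_apply]
  refine Submodule.sum_mem _ fun v hv => Submodule.smul_mem _ _ ?_
  have hadj := (isFlagComplex_sublevelRips hn p).rel_of_mem_chains hc
    (Finsupp.mem_support_iff.1 hv) 0 1
  by_cases hdir : (label hn (v 0)).2 = (label hn (v 1)).2
  · rw [hdir, crossing_self, Int.cast_zero, Finsupp.single_zero]
    exact zero_mem _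
  · refine mem_chains_zero_iff.2 fun w hw => ?_
    obtain rfl : ![(label hn (v 0)).plane] = w :=
      by_contra fun h => hw (Finsupp.single_eq_of_ne' h)
    exact singleton_plane_mem_modelFiltration (by omega) hadj hdir

theorem map_winding_boundary_eq_zero {N : Type*} [AddCommGroup N] [Module 𝔽 N]
    {L : ((Fin 1 → Fin (n + 1)) →₀ 𝔽) →ₗ[𝔽] N}
    (hL : ∀ v w : WitnessLabel n, Adj p v w →
      L (Finsupp.single ![v.plane] 1) = L (Finsupp.single ![w.plane] 1))
    {c : (Fin 3 → witnessSet n) →₀ 𝔽}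
    (hc : c ∈ simplicialChains 𝔽 (sublevelRips (witnessGamma n) (gridEmbedding n 1 p)) 2) :
    L (winding hn 𝔽 (simplicialBoundary 𝔽 _ 2 c)) = 0 := by
  refine map_eq_zero_of_map_orientedSimplex_eq_zero
    (L ∘ₗ winding hn 𝔽 ∘ₗ simplicialBoundary 𝔽 _ 2) hc fun v hv => ?_
  have hadj := (isFlagComplex_sublevelRips hn p).rel_of_mem_chains hc hv
  have hedge (i j : Fin 3) : L (winding hn 𝔽 (orientedSimplex 𝔽 ![v i, v j])) =
      ((crossing (label hn (v i)).2 (label hn (v j)).2 -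
        crossing (label hn (v j)).2 (label hn (v i)).2 : ℤ) : 𝔽) •
          L (Finsupp.single ![(label hn (v 0)).plane] 1) := by
    have hplane (k : Fin 3) (x : 𝔽) : L (Finsupp.single ![(label hn (v k)).plane] x) =
        x • L (Finsupp.single ![(label hn (v 0)).plane] 1) := by
      rw [← hL _ _ (hadj k 0), ← map_smul, Finsupp.smul_single, smul_eq_mul, mul_one]
    rw [winding_orientedSimplex, map_sub, hplane i, hplane j, Int.cast_sub, sub_smul]
  have hv' : v = ![v 0, v 1, v 2] := List.ofFn_inj.1 (by simp)
  have hcross := crossing_triangle (hadj 0 1).2.1.1 (hadj 1 2).2.1.1 (hadj 2 0).2.1.1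
  rw [LinearMap.comp_apply, LinearMap.comp_apply, hv', simplicialBoundary_triple, map_add, map_add,
    map_add, map_add, hedge, hedge, hedge, ← add_smul, ← add_smul, ← Int.cast_add, ← Int.cast_add,
    hcross, Int.cast_zero, zero_smul]

theorem winding_mem_boundaries {c : (Fin 2 → witnessSet n) →₀ 𝔽}
    (hc : c ∈ simplicialBoundaries 𝔽 (sublevelRips (witnessGamma n) (gridEmbedding n 1 p)) 1) :
    winding hn 𝔽 c ∈ simplicialBoundaries 𝔽 (modelFiltration n p) 0 := by
  obtain ⟨d, hd, rfl⟩ := hc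
  by_cases hp : p = ⊤
  · subst hp
    exact mem_modelFiltration_boundaries (map_winding_boundary_eq_zero
      (fun v w _ => by rw [augmentation_single, augmentation_single]) hd)
  · rw [modelFiltration_boundaries_eq_bot hp, Submodule.mem_bot]
    exact map_winding_boundary_eq_zero (L := LinearMap.id)
      (fun v w h => by rw [plane_eq_of_level_eq (h.level_eq_of_ne_top hp)]) hd

theorem exists_eq_boundary_add_winding {φ : ((Fin 2 → witnessSet n) →₀ 𝔽) →ₗ[𝔽] 𝔽}
    (hφ : simplicialBoundaries 𝔽 (sublevelRips (witnessGamma n) (gridEmbedding n 1 p)) 1 ≤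
      LinearMap.ker φ) :
    ∃ (F : ((Fin 1 → witnessSet n) →₀ 𝔽) →ₗ[𝔽] 𝔽) (Λ : ((Fin 1 → Fin (n + 1)) →₀ 𝔽) →ₗ[𝔽] 𝔽),
      (p = ⊤ → ∃ a : 𝔽, Λ = a • augmentation 𝔽 (Fin (n + 1))) ∧
      ∀ c ∈ simplicialChains 𝔽 (sublevelRips (witnessGamma n) (gridEmbedding n 1 p)) 1,
        φ c = F (simplicialBoundary 𝔽 _ 1 c) + Λ (winding hn 𝔽 c) := by
  have hK := isFlagComplex_sublevelRips hn p
  have hg := hK.isOneCocycle (fun _ _ => Adj.symm) (fun _ _ => Adj.refl_left) hφ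
  have hg' : IsOneCocycle (Adj p) fun v w =>
      φ (orientedSimplex 𝔽 ![(label hn).symm v, (label hn).symm w]) :=
    ⟨fun _ => hg.self_eq_zero _, fun _ _ => hg.eq_neg_swap _ _,
      fun u v w huv hvw huw => hg.add_eq _ _ _ (by simpa using huv) (by simpa using hvw)
        (by simpa using huw)⟩
  obtain ⟨f, l, hl, hpot⟩ := exists_potential (by omega) hg'
  let F : ((Fin 1 → witnessSet n) →₀ 𝔽) →ₗ[𝔽] 𝔽 :=
    Finsupp.linearCombination 𝔽 fun v => f (label hn (v 0))
  let Λ : ((Fin 1 → Fin (n + 1)) →₀ 𝔽) →ₗ[𝔽] 𝔽 := Finsupp.linearCombination 𝔽 fun v => l (v 0)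
  refine ⟨F, Λ, fun hp => ⟨l 0, ?_⟩, fun c hc => ?_⟩
  · ext v
    simp [Λ, augmentation_single, hl hp (v 0) 0]
  · rw [← sub_eq_zero]
    refine map_eq_zero_of_map_orientedSimplex_eq_zero
      (φ - (F ∘ₗ simplicialBoundary 𝔽 _ 1 + Λ ∘ₗ winding hn 𝔽)) hc fun v hv => ?_
    obtain ⟨x, y, rfl⟩ : ∃ x y, v = ![x, y] := ⟨v 0, v 1, List.ofFn_inj.1 (by simp)⟩
    have hxy := hpot _ _ (hK.rel_of_mem_chains hc hv 0 1)
    simp only [Matrix.cons_val_zero, Matrix.cons_val_one, Equiv.symm_apply_apply] at hxy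
    simp [F, Λ, simplicialBoundary_pair, winding_orientedSimplex, hxy]

theorem mem_boundaries_of_winding_mem_boundaries {c : (Fin 2 → witnessSet n) →₀ 𝔽}
    (hc : c ∈ simplicialCycles 𝔽 (sublevelRips (witnessGamma n) (gridEmbedding n 1 p)) 1)
    (hw : winding hn 𝔽 c ∈ simplicialBoundaries 𝔽 (modelFiltration n p) 0) :
    c ∈ simplicialBoundaries 𝔽 (sublevelRips (witnessGamma n) (gridEmbedding n 1 p)) 1 := by
  by_contra hcB
  obtain ⟨φ, hφc, hφ⟩ := Submodule.exists_le_ker_of_notMem hcB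
  obtain ⟨F, Λ, hΛ, hφeq⟩ := exists_eq_boundary_add_winding (hn := hn) hφ
  rw [mem_simplicialCycles_one_iff] at hc
  have hΛw : Λ (winding hn 𝔽 c) = 0 := by
    by_cases hp : p = ⊤
    · obtain ⟨a, rfl⟩ := hΛ hp
      rw [LinearMap.smul_apply, augmentation_eq_zero_of_mem_boundaries hw, smul_zero]
    · rw [modelFiltration_boundaries_eq_bot hp, Submodule.mem_bot] at hw
      rw [hw, map_zero]
  exact hφc (by rw [hφeq c hc.1, hc.2, map_zero, hΛw, add_zero])

theorem exists_adj_of_singleton_mem_modelFiltration (hn : 0 < n) {k : Fin (n + 1)}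
    (hk : {k} ∈ (modelFiltration n p).faces) :
    ∃ j : {j : Fin (n + 1) // j ≠ k}, ∀ a b : Fin 4, b ≠ a + 2 →
      Adj p (Sum.inl ⟨(k, j.1), j.2⟩, a) (Sum.inl ⟨(k, j.1), j.2⟩, b) := by
  obtain ⟨hsum, hne⟩ := (singleton_mem_modelFiltration hn).1 hk
  obtain ⟨j, hjk, hj1, hj2⟩ : ∃ j : Fin (n + 1), j ≠ k ∧ (j : ℕ) ≤ p.1 ∧ n ≤ (j : ℕ) + p.2 := by
    by_cases h : p.1 = k
    · have hsum' : (p.1 : ℕ) + p.2 ≠ n := fun e => hne e h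
      refine ⟨⟨p.1 - 1, by omega⟩, fun e => ?_, ?_, ?_⟩
      · have := congrArg Fin.val (e.trans h.symm)
        dsimp only at this
        omega
      all_goals dsimp only; omega
    · exact ⟨p.1, h, le_rfl, hsum⟩
  exact ⟨⟨j, hjk⟩, fun a b hab => ⟨⟨hj1, hj1⟩, ⟨hab, Or.inr ⟨hj2, hj2⟩⟩, Or.inl rfl⟩⟩

theorem exists_cycle_winding_eq_single {k : Fin (n + 1)}
    (hk : {k} ∈ (modelFiltration n p).faces) :
    ∃ c ∈ simplicialCycles 𝔽 (sublevelRips (witnessGamma n) (gridEmbedding n 1 p)) 1,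
      winding hn 𝔽 c = Finsupp.single ![k] 1 := by
  obtain ⟨⟨j, hjk⟩, hadj⟩ := exists_adj_of_singleton_mem_modelFiltration (by omega) hk
  let v (a : Fin 4) : WitnessLabel n := (Sum.inl ⟨(k, j), hjk⟩, a)
  let x (a : Fin 4) : witnessSet n := (label hn).symm (v a)
  have hlabel (a : Fin 4) : label hn (x a) = v a := (label hn).apply_symm_apply _
  have hx : Function.Injective x := fun a b h => congrArg Prod.snd ((label hn).symm.injective h)
  have hedge (a : Fin 4) : orientedSimplex 𝔽 ![x a, x (a + 1)] ∈
      simplicialChains 𝔽 (sublevelRips (witnessGamma n) (gridEmbedding n 1 p)) 1 := by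
    have hdir : a ≠ a + 1 ∧ a + 1 ≠ a + 2 := by
      revert a
      decide
    have h := hadj a (a + 1) hdir.2
    refine (isFlagComplex_sublevelRips hn p).orientedSimplex_mem_chains
      (List.nodup_ofFn.1 (by simpa using hx.ne hdir.1)) fun i i' => ?_
    fin_cases i <;> fin_cases i' <;>
      simp only [Fin.zero_eta, Fin.mk_one, Matrix.cons_val_zero, Matrix.cons_val_one, hlabel]
    exacts [h.refl_left, h, h.symm, h.symm.refl_left]
  refine ⟨∑ a, orientedSimplex 𝔽 ![x a, x (a + 1)],
    mem_simplicialCycles_one_iff.2 ⟨Submodule.sum_mem _ fun a _ => hedge a, ?_⟩, ?_⟩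
  · simp only [map_sum, simplicialBoundary_pair, Finset.sum_sub_distrib]
    rw [sub_eq_zero]
    exact Equiv.sum_comp (Equiv.addRight (1 : Fin 4)) fun a => Finsupp.single ![x a] (1 : 𝔽)
  · simp only [map_sum, winding_orientedSimplex, hlabel]
    simp [Fin.sum_univ_four, crossing, v, plane]

theorem exists_cycle_winding_eq {d : (Fin 1 → Fin (n + 1)) →₀ 𝔽}
    (hd : d ∈ simplicialChains 𝔽 (modelFiltration n p) 0) :
    ∃ c ∈ simplicialCycles 𝔽 (sublevelRips (witnessGamma n) (gridEmbedding n 1 p)) 1,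
      winding hn 𝔽 c = d := by
  change d ∈ (simplicialCycles 𝔽 (sublevelRips (witnessGamma n) (gridEmbedding n 1 p)) 1).map
    (winding hn 𝔽)
  rw [← Finsupp.sum_single d]
  refine Submodule.sum_mem _ fun v hv => ?_
  obtain ⟨c, hc, hcv⟩ := exists_cycle_winding_eq_single (𝔽 := 𝔽) (hn := hn)
    (mem_chains_zero_iff.1 hd v (Finsupp.mem_support_iff.1 hv))
  have hv0 : ![v 0] = v := List.ofFn_inj.1 (by simp)
  refine ⟨d v • c, Submodule.smul_mem _ _ hc, ?_⟩
  rw [map_smul, hcv, hv0, Finsupp.smul_single, smul_eq_mul, mul_one]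

variable (hn 𝔽 p)

/-- The winding numbers identify the first homology of the sublevel-Rips complex of the witness
with the homology of the model at a point of the grid. -/
noncomputable def homologyEquiv :
    SimplicialHomology 𝔽 (sublevelRips (witnessGamma n) (gridEmbedding n 1 p)) 1 ≃ₗ[𝔽]
      SimplicialHomology 𝔽 (modelFiltration n p) 0 :=
  LinearEquiv.ofBijective
    (Subquotient.mapOfLinear (winding hn 𝔽)
      (fun _ hc => simplicialCycles_zero (𝔽 := 𝔽) (modelFiltration n p) ▸
        winding_mem_chains (mem_simplicialCycles_one_iff.1 hc).1)
      (fun _ hc => winding_mem_boundaries hc))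
    (Subquotient.mapOfLinear_bijective _ _ _
      (fun _ hc hw => mem_boundaries_of_winding_mem_boundaries hc hw)
      (fun _ hd => exists_cycle_winding_eq (simplicialCycles_zero (𝔽 := 𝔽) _ ▸ hd)))

/-- The isomorphism of persistence modules given by the winding numbers. -/
noncomputable def homologyIso :
    (persistentHomology 𝔽 (sublevelRips (witnessGamma n)) 1).comap (gridEmbedding n 1) ≅
      modelModule 𝔽 n :=
  PersistenceModule.isoOfComponents (fun p => (homologyEquiv hn 𝔽 p).toModuleIso) fun p q h => by
    ext x
    obtain ⟨x, rfl⟩ := Subquotient.mk_surjective _ _ x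
    rfl

end Winding

end WitnessLabel

/-! ### Size of the diagrams -/

theorem gridEmbedding_sup {n : ℕ} (s : ℝ≥0) (p q : Fin (n + 1) × Fin (n + 1)) :
    gridEmbedding n s (p ⊔ q) = gridEmbedding n s p ⊔ gridEmbedding n s q := by
  have hvalue {i j : Fin (n + 1)} (h : i ≤ j) (k : Fin (n + 1)) :
      (gridEmbedding n s (i, k)).1 ≤ (gridEmbedding n s (j, k)).1 :=
    ((gridEmbedding n s).monotone (Prod.mk_le_mk.2 ⟨h, le_rfl⟩)).1
  have hradius {i j : Fin (n + 1)} (h : i ≤ j) (k : Fin (n + 1)) :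
      (gridEmbedding n s (k, i)).2 ≤ (gridEmbedding n s (k, j)).2 :=
    ((gridEmbedding n s).monotone (Prod.mk_le_mk.2 ⟨le_rfl, h⟩)).2
  obtain ⟨i, j⟩ := p
  obtain ⟨i', j'⟩ := q
  rw [Prod.mk_sup_mk]
  refine Prod.ext ?_ ?_
  · rcases le_total i i' with h | h
    · rw [sup_eq_right.2 h]
      exact (sup_eq_right.2 (hvalue h j)).symm
    · rw [sup_eq_left.2 h]
      exact (sup_eq_left.2 (hvalue h j)).symm
  · rcases le_total j j' with h | h
    · rw [sup_eq_right.2 h]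
      exact (sup_eq_right.2 (hradius h i)).symm
    · rw [sup_eq_left.2 h]
      exact (sup_eq_left.2 (hradius h i)).symm

theorem sublevelCech_comp_gridEmbedding (n : ℕ) (s : ℝ≥0) :
    (sublevelCech (witnessGamma n)).comp (gridEmbedding n s) =
      (sublevelRips (witnessGamma n)).comp (gridEmbedding n (2 * s)) := by
  refine OrderHom.ext _ _ (funext fun p => ?_)
  refine (cechComplex_eq_ripsComplex _ _).trans ?_
  exact congrArg (ripsComplex _) (mul_assoc _ _ _).symm

theorem persistentHomology_comap (𝔽 : Type u) [Field 𝔽] {P Q V : Type} [PartialOrder P]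
    [PartialOrder Q] (F : P →o PreAbstractSimplicialComplex V) (g : Q →o P) (m : ℕ) :
    (persistentHomology 𝔽 F m).comap g = persistentHomology 𝔽 (F.comp g) m :=
  rfl

theorem comap_sublevelCech_eq_comap_sublevelRips (𝔽 : Type u) [Field 𝔽] (n : ℕ) :
    (persistentHomology 𝔽 (sublevelCech (witnessGamma n)) 1).comap (gridEmbedding n (1 / 2)) =
      (persistentHomology 𝔽 (sublevelRips (witnessGamma n)) 1).comap (gridEmbedding n 1) := by
  rw [persistentHomology_comap, persistentHomology_comap, sublevelCech_comp_gridEmbedding,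
    mul_one_div_cancel (two_ne_zero' ℝ≥0)]

section Witness

variable (𝔽 : Type u) [Field 𝔽] {n : ℕ} (hn : 2 ≤ n)

/-- The isomorphism for the sublevel-Čech filtration, at half the radii of the sublevel-Rips
filtration. -/
noncomputable def WitnessLabel.homologyIsoCech :
    (persistentHomology 𝔽 (sublevelCech (witnessGamma n)) 1).comap (gridEmbedding n (1 / 2)) ≅
      modelModule 𝔽 n :=
  eqToIso (comap_sublevelCech_eq_comap_sublevelRips 𝔽 n) ≪≫ WitnessLabel.homologyIso hn 𝔽

include hn in
theorem two_pow_sub_one_le_gpdSize_sublevelRips :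
    (2 ^ (n + 1) - 1 : ℕ) ≤ gpdSize (persistentHomology 𝔽 (sublevelRips (witnessGamma n)) 1) := by
  have : Finite (witnessSet n) := finite_witnessSet hn
  exact two_pow_sub_one_le_gpdSize hn (hasFiniteGPD_sublevelRips _ 1) _ (gridEmbedding_sup 1)
    (WitnessLabel.homologyIso hn 𝔽)

include hn in
theorem two_pow_sub_one_le_gpdSize_sublevelCech :
    (2 ^ (n + 1) - 1 : ℕ) ≤ gpdSize (persistentHomology 𝔽 (sublevelCech (witnessGamma n)) 1) := by
  have : Finite (witnessSet n) := finite_witnessSet hn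
  exact two_pow_sub_one_le_gpdSize hn (hasFiniteGPD_sublevelCech _ 1) _ (gridEmbedding_sup _)
    (WitnessLabel.homologyIsoCech 𝔽 hn)

end Witness

theorem exists_mul_pow_lt_two_pow (k C N : ℕ) : ∃ n : ℕ, 2 ≤ n ∧ N ≤ 4 * n * (n + 2) ∧
    C * (4 * n * (n + 2)) ^ k < 2 ^ (n + 1) - 1 := by
  have hlim := tendsto_pow_const_div_const_pow_of_one_lt (2 * k) (one_lt_two (α := ℝ))
  have hpos : (0 : ℝ) < 1 / (C * 12 ^ k + 1) := by positivity
  obtain ⟨n, hlt, hn⟩ := ((hlim.eventually_lt_const hpos).and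
    (Filter.eventually_ge_atTop (max 2 N))).exists
  obtain ⟨hn2, hnN⟩ := max_le_iff.1 hn
  refine ⟨n, hn2, by nlinarith, ?_⟩
  have hexp : n ^ (2 * k) * (C * 12 ^ k + 1) < 2 ^ n := by
    rw [div_lt_div_iff₀ (by positivity) (by positivity), one_mul] at hlt
    exact_mod_cast hlt
  have hcard : (4 * n * (n + 2)) ^ k ≤ 12 ^ k * n ^ (2 * k) := by
    rw [pow_mul, ← mul_pow]
    exact Nat.pow_le_pow_left (by nlinarith) k
  calc C * (4 * n * (n + 2)) ^ k ≤ C * (12 ^ k * n ^ (2 * k)) := Nat.mul_le_mul_left C hcard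
    _ ≤ n ^ (2 * k) * (C * 12 ^ k + 1) := by nlinarith [Nat.zero_le (n ^ (2 * k))]
    _ < 2 ^ n := hexp
    _ ≤ 2 ^ (n + 1) - 1 := by have := Nat.one_le_two_pow (n := n); omega

theorem exists_ncard_witnessSet_lt {size : ℕ → ℕ∞}
    (hsize : ∀ n, 2 ≤ n → (2 ^ (n + 1) - 1 : ℕ) ≤ size n) (k C N : ℕ) :
    ∃ n, 2 ≤ n ∧ N ≤ (witnessSet n).ncard ∧ (C * (witnessSet n).ncard ^ k : ℕ) < size n := by
  obtain ⟨n, hn, hN, hlt⟩ := exists_mul_pow_lt_two_pow k C N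
  rw [← ncard_witnessSet hn] at hN hlt
  exact ⟨n, hn, hN, (Nat.cast_lt.2 hlt).trans_le (hsize n hn)⟩

theorem mainTheorem2 (𝔽 : Type u) [Field 𝔽] :
    -- the generalized persistence diagrams in question are well defined
    (∀ (X : Type) [MetricSpace X] [Finite X] (γ : X → ℝ),
      HasFiniteGPD (persistentHomology 𝔽 (sublevelRips γ) 1)) ∧
    (∀ (d : ℕ) (_ : MetricSpace (Fin d → ℝ)) (X : Set (Fin d → ℝ)) (_ : X.Finite) (γ : X → ℝ),
      HasFiniteGPD (persistentHomology 𝔽 (sublevelCech γ) 1)) ∧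
    -- no polynomial bound for sublevel-Rips
    (¬ ∃ k C N : ℕ, ∀ (X : Type) [MetricSpace X] [Finite X] (γ : X → ℝ), N ≤ Nat.card X →
      gpdSize (persistentHomology 𝔽 (sublevelRips γ) 1) ≤ (C * Nat.card X ^ k : ℕ)) ∧
    -- no polynomial bound for sublevel-Čech
    (¬ ∃ k C N : ℕ, ∀ (d : ℕ) (_ : MetricSpace (Fin d → ℝ)) (X : Set (Fin d → ℝ)) (_ : X.Finite)
      (γ : X → ℝ), N ≤ X.ncard →
      gpdSize (persistentHomology 𝔽 (sublevelCech γ) 1) ≤ (C * X.ncard ^ k : ℕ)) ∧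
    -- the explicit witnesses
    (∀ n : ℕ, 2 ≤ n →
      (witnessSet n).ncard = 4 * n * (n + 2) ∧
      Nonempty ((persistentHomology 𝔽 (sublevelRips (witnessGamma n)) 1).comap (gridEmbedding n 1) ≅
        modelModule 𝔽 n) ∧
      Nonempty ((persistentHomology 𝔽 (sublevelCech (witnessGamma n)) 1).comap
        (gridEmbedding n (1 / 2)) ≅ modelModule 𝔽 n) ∧
      HasFiniteGPD (modelModule 𝔽 n) ∧
      (2 ^ (n + 1) - 1 : ℕ) ≤ gpdSize (modelModule 𝔽 n) ∧
      (2 ^ (n + 1) - 1 : ℕ) ≤ gpdSize (persistentHomology 𝔽 (sublevelRips (witnessGamma n)) 1) ∧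
      (2 ^ (n + 1) - 1 : ℕ) ≤
        gpdSize (persistentHomology 𝔽 (sublevelCech (witnessGamma n)) 1)) := by
  refine ⟨fun X _ _ γ => hasFiniteGPD_sublevelRips γ 1,
    fun d _ X hX γ => have : Finite X := hX; hasFiniteGPD_sublevelCech γ 1, ?_, ?_, fun n hn =>
    ⟨ncard_witnessSet hn, ⟨WitnessLabel.homologyIso hn 𝔽⟩, ⟨WitnessLabel.homologyIsoCech 𝔽 hn⟩,
      hasFiniteGPD_of_finite _,
      two_pow_sub_one_le_gpdSize hn (hasFiniteGPD_of_finite _) OrderHom.id (fun _ _ => rfl)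
        (Iso.refl _),
      two_pow_sub_one_le_gpdSize_sublevelRips 𝔽 hn, two_pow_sub_one_le_gpdSize_sublevelCech 𝔽 hn⟩⟩
  · rintro ⟨k, C, N, hbound⟩
    obtain ⟨n, hn, hN, hlt⟩ := exists_ncard_witnessSet_lt
      (fun n hn => two_pow_sub_one_le_gpdSize_sublevelRips 𝔽 hn) k C N
    have : Finite (witnessSet n) := finite_witnessSet hn
    rw [← Nat.card_coe_set_eq] at hN hlt
    exact (hbound _ (witnessGamma n) hN).not_gt hlt
  · rintro ⟨k, C, N, hbound⟩
    obtain ⟨n, hn, hN, hlt⟩ := exists_ncard_witnessSet_lt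
      (fun n hn => two_pow_sub_one_le_gpdSize_sublevelCech 𝔽 hn) k C N
    exact (hbound 3 inferInstance _ (finite_witnessSet hn) (witnessGamma n) hN).not_gt hlt
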